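/- Let $q$ be an odd prime power, let $r>3$ be an integer, and let $\alpha\in\mathrm{GF}(q^2)$, $\alpha\neq 0$, and $\beta\in\mathrm{GF}(q^2)\setminus\mathrm{GF}(q)$ be such that either $r$ is odd and $4\alpha^{q+1}+(\beta^q-\beta)^2\neq 0$, or $r$ is even and $4\alpha^{q+1}+(\beta^q-\beta)^2$ is a non-square in $\mathrm{GF}(q)$. Let $\mathcal B$ be the set of $\mathrm{GF}(q^2)$-rational points of the hypersurface of $\mathrm{PG}(r,q^2)$, with homogeneous coordinates $(X_0,\dots,X_r)$, that is obtained by homogenizing with respect to $X_0$ (where $x_i=X_i/X_0$) the equation of degree $2q$ $$x_r^q-x_r+\alpha^q(x_1^{2q}+\dots+x_{r-1}^{2q})-\alpha(x_1^2+\dots+x_{r-1}^2)=(\beta^q-\beta)(x_1^{q+1}+\dots+x_{r-1}^{q+1}).$$ Let $\mathcal C(\mathcal B)$ be a projective code determined by $\mathcal B$, that is, the linear code over $\mathrm{GF}(q^2)$ generated by the rows of a matrix whose columns are coordinate vectors of the points of $\mathcal B$, one column for each point (in any order and with any choice of the coordinate vectors). Then $\mathcal C(\mathcal B)$ has the following properties.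 * Its length is $N=q^{2r-1}+q^{r-1}+\frac{q^{2(r-1)}-q^2}{q^2-1}+1$ if $r$ is odd, and $N=q^{2r-1}+\frac{q^{2(r-1)}-q^2}{q^2-1}+1$ if $r$ is even; its dimension is $r+1$. * The set of the Hamming weights of its nonzero codewords is $\{w_1,w_2,w_3,w_4,w_5\}$, with five distinct elements, where for $r$ odd $$w_1=q^{2r-1},\quad w_2=q^{2r-1}-q^{2r-3}+q^{2(r-2)}+q^{r-1}+q^{r-2}-q^{r-3},\quad w_3=q^{2r-1}-q^{2r-3}+q^{2(r-2)}+q^{r-1},$$ $$w_4=q^{2r-1}-q^{2r-3}+q^{2(r-2)}+q^{r-2}-q^{r-3},\quad w_5=q^{2r-1}-q^{2r-3}+q^{2(r-2)},$$ and for $r$ even $$w_1=q^{2r-1},\quad w_2=q^{2r-1}-q^{2r-3}+q^{2(r-2)}+q^{r-1}-q^{r-2},\quad w_3=q^{2r-1}-q^{2r-3}+q^{2(r-2)}+q^{r-2},$$ $$w_4=q^{2r-1}-q^{2r-3}+q^{2(r-2)},\quad w_5=q^{2r-1}-q^{2r-3}+q^{2(r-2)}-q^{r-2}.$$ * It is $q$-divisible: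 $q$ divides the weight of every codeword. * It is minimal: whenever $c,c'$ are codewords such that the support of $c'$ is contained in the support of $c$, then $c'=\lambda c$ for some $\lambda\in\mathrm{GF}(q^2)$. * The minimum $w_{\min}$ and the maximum $w_{\max}$ of the weights of its nonzero codewords satisfy the Ashikhmin–Barg inequality $\frac{w_{\min}}{w_{\max}}>\frac{q^2-1}{q^2}$. -/

import Mathlib

open scoped LinearAlgebra.Projectivization

namespace MinimalCodes

/-! ### The hypersurface -/

section Hypersurface

variable {K : Type*} [Field K]

/-- The homogeneous polynomial of degree `2 q` in `X_0, …, X_r` obtained by homogenizing, with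
respect to `X_0`, the affine equation
`x_r^q - x_r + α^q (x_1^{2q} + ⋯ + x_{r-1}^{2q}) - α (x_1^2 + ⋯ + x_{r-1}^2)
  = (β^q - β) (x_1^{q+1} + ⋯ + x_{r-1}^{q+1})`. -/
noncomputable def hypersurfacePoly (q r : ℕ) (α β : K) : MvPolynomial (Fin (r + 1)) K :=
  let X : Fin (r + 1) → MvPolynomial (Fin (r + 1)) K := MvPolynomial.X
  let I : Finset (Fin (r + 1)) := Finset.Ioo 0 (Fin.last r)
  X (Fin.last r) ^ q * X 0 ^ q - X (Fin.last r) * X 0 ^ (2 * q - 1)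
    + MvPolynomial.C (α ^ q) * ∑ i ∈ I, X i ^ (2 * q)
    - MvPolynomial.C α * (∑ i ∈ I, X i ^ 2) * X 0 ^ (2 * q - 2)
    - MvPolynomial.C (β ^ q - β) * (∑ i ∈ I, X i ^ (q + 1)) * X 0 ^ (q - 1)

/-- The set of `K`-rational points of the projective hypersurface in `PG(r, K)`. -/
def hypersurface (q r : ℕ) (α β : K) : Set (ℙ K (Fin (r + 1) → K)) :=
  {P | MvPolynomial.eval P.rep (hypersurfacePoly q r α β) = 0}

theorem hypersurfacePoly_isHomogeneous {q : ℕ} (hq : 0 < q) (r : ℕ) (α β : K) :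
    (hypersurfacePoly q r α β).IsHomogeneous (2 * q) := by
  have hX : ∀ (i : Fin (r + 1)) (n : ℕ),
      (MvPolynomial.X i ^ n : MvPolynomial (Fin (r + 1)) K).IsHomogeneous n := fun i n => by
    simpa using (MvPolynomial.isHomogeneous_X K i).pow n
  have hS : ∀ n : ℕ, (∑ i ∈ Finset.Ioo 0 (Fin.last r),
      (MvPolynomial.X i ^ n : MvPolynomial (Fin (r + 1)) K)).IsHomogeneous n := fun n =>
    MvPolynomial.IsHomogeneous.sum _ _ _ fun i _ => hX i n
  have hC : ∀ a : K, (MvPolynomial.C a : MvPolynomial (Fin (r + 1)) K).IsHomogeneous 0 :=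
    fun a => MvPolynomial.isHomogeneous_C _ a
  have h1 := (hX (Fin.last r) q).mul (hX 0 q)
  have h2 := (MvPolynomial.isHomogeneous_X K (Fin.last r)).mul (hX 0 (2 * q - 1))
  have h3 := (hC (α ^ q)).mul (hS (2 * q))
  have h4 := ((hC α).mul (hS 2)).mul (hX 0 (2 * q - 2))
  have h5 := ((hC (β ^ q - β)).mul (hS (q + 1))).mul (hX 0 (q - 1))
  rw [show q + q = 2 * q by omega] at h1
  rw [show 1 + (2 * q - 1) = 2 * q by omega] at h2
  rw [show 0 + 2 * q = 2 * q by omega] at h3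
  rw [show 0 + 2 + (2 * q - 2) = 2 * q by omega] at h4
  rw [show 0 + (q + 1) + (q - 1) = 2 * q by omega] at h5
  exact (((h1.sub h2).add h3).sub h4).sub h5

/-- Membership in the hypersurface may be tested on any representative of a point. -/
theorem mk_mem_hypersurface {q : ℕ} (hq : 0 < q) (r : ℕ) (α β : K) (v : Fin (r + 1) → K)
    (hv : v ≠ 0) :
    Projectivization.mk K v hv ∈ hypersurface q r α β ↔
      MvPolynomial.eval v (hypersurfacePoly q r α β) = 0 := by
  obtain ⟨a, ha⟩ := Projectivization.exists_smul_eq_mk_rep K v hv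
  have hf := hypersurfacePoly_isHomogeneous hq r α β
  have h : MvPolynomial.eval ((a : K) • v) (hypersurfacePoly q r α β)
      = (a : K) ^ (2 * q) * MvPolynomial.eval v (hypersurfacePoly q r α β) := by
    rw [MvPolynomial.eval_eq', MvPolynomial.eval_eq', Finset.mul_sum]
    refine Finset.sum_congr rfl fun d hd => ?_
    have hd' : ∑ i, d i = 2 * q := by
      rw [← hf (MvPolynomial.mem_support_iff.mp hd), Finsupp.weight_apply,
        Finsupp.sum_fintype _ _ (by simp)]
      simp
    simp only [Pi.smul_apply, smul_eq_mul, mul_pow, Finset.prod_mul_distrib,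
      Finset.prod_pow_eq_pow_sum, hd']
    ring
  change MvPolynomial.eval (Projectivization.mk K v hv).rep _ = 0 ↔ _
  rw [← ha, Units.smul_def, h]
  simp

/-- In the affine chart `X_0 = 1` the hypersurface is given by the affine equation. -/
theorem eval_hypersurfacePoly_affine (q r : ℕ) (α β : K) (v : Fin (r + 1) → K) (hv : v 0 = 1) :
    MvPolynomial.eval v (hypersurfacePoly q r α β) = 0 ↔
      v (Fin.last r) ^ q - v (Fin.last r) + α ^ q * ∑ i ∈ Finset.Ioo 0 (Fin.last r), v i ^ (2 * q)
        - α * ∑ i ∈ Finset.Ioo 0 (Fin.last r), v i ^ 2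
        = (β ^ q - β) * ∑ i ∈ Finset.Ioo 0 (Fin.last r), v i ^ (q + 1) := by
  simp [hypersurfacePoly, hv, sub_eq_zero]

end Hypersurface

/-! ### Linear codes -/

section Codes

variable {K : Type*} [Field K] {n : ℕ}

/-- The linear code of length `n` having the rows of `G` as generators. -/
def rowCode {k : ℕ} (G : Matrix (Fin k) (Fin n) K) : Submodule K (Fin n → K) :=
  Submodule.span K (Set.range G.row)

/-- `C` is a projective code determined by the set `S` of points of `PG(r, K)`: it is generated by
the rows of a matrix whose columns are coordinate vectors of the points of `S`, each point being
used exactly once, in an arbitrary order and with an arbitrary choice of coordinate vectors. -/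
def IsProjectiveCodeOf {r : ℕ} (S : Set (ℙ K (Fin (r + 1) → K)))
    (C : Submodule K (Fin n → K)) : Prop :=
  ∃ (P : Fin n ≃ S) (G : Matrix (Fin (r + 1)) (Fin n) K),
    (∀ j, ∃ h : G.col j ≠ 0, Projectivization.mk K (G.col j) h = P j) ∧ C = rowCode G

/-- The set of Hamming weights of the nonzero words of `C`. -/
def nonzeroWeights [DecidableEq K] (C : Submodule K (Fin n → K)) : Set ℕ :=
  {w | ∃ c ∈ C, c ≠ 0 ∧ hammingNorm c = w}

/-- All the weights of `C` are divisible by `d`. -/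
def IsDivisibleCode [DecidableEq K] (d : ℕ) (C : Submodule K (Fin n → K)) : Prop :=
  ∀ c ∈ C, d ∣ hammingNorm c

/-- A word `c` of `C` is minimal if every word of `C` whose support is contained in the support
of `c` is a scalar multiple of `c`. -/
def IsMinimalWord (C : Submodule K (Fin n → K)) (c : Fin n → K) : Prop :=
  ∀ c' ∈ C, Function.support c' ⊆ Function.support c → ∃ a : K, c' = a • c

/-- A linear code is minimal if all its words are minimal. -/
def IsMinimalCode (C : Submodule K (Fin n → K)) : Prop :=
  ∀ c ∈ C, IsMinimalWord C c

end Codes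

end MinimalCodes

/-! Write Q = q², m = r - 1, and σ for the involution x ↦ x^q of K over F. The weight of the word
with coefficient vector a is the number of points of the hypersurface off the hyperplane ∑ a_i X_i =
0, so everything reduces to counting hyperplane sections, done on the affine cone and divided by Q -
1.

The affine equation says that σ fixes x_r - h(x), where h(x) = ∑ (β x_i σ(x_i) - α x_i²); hence
there are q Q^m affine points. At X_0 = 0 only the term in α^q survives, and it leaves the cone ∑
x_i² = 0 with x_r free.

For a hyperplane involving X_r, substituting for x_r gives the condition that σ fixes c₀ + ∑ c_i x_i
+ h(x). Dividing the difference with its conjugate by γ = σ(β) - β and completing the square turns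
this into ∑ φ(x_i) = k, where φ(x) = xσ(x) + μx² + σ(μx²) and μ = α/γ (`numSol_affine_hyperplane`).
On the F-plane K, the form φ is nondegenerate exactly when 4μσ(μ) ≠ 1, that is, when 4α^{q+1} + γ² ≠
0. A nondegenerate binary form takes its nonzero values equally often, with bias q or -q according
to whether it is isotropic, and biases multiply over direct sums (`HasBias.add`). The m copies of φ
thus have bias (±q)^m. For r odd the sign disappears; for r even the non-square hypothesis makes φ
anisotropic and fixes the sign.

For a hyperplane free of X_r the affine count is linear, and the points at infinity require the
zeros of ∑ x_j² off a hyperplane b^⊥ of K^m. They depend on whether ∑ b_j² vanishes and, for m odd,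
on its square class. As -1 is a square in K, sums of squares split into hyperbolic planes over K and
the same bias calculus applies.

The resulting five weights are positive, so encoding is injective and the dimension is r + 1. They
are sums and differences of positive powers of q, whence divisibility; and the extreme ones satisfy
the Ashikhmin–Barg inequality, whence minimality. -/

namespace MinimalCodes

/-! ### Counting solutions -/

section Counting

variable {V W F : Type*}

/-- The number of elements satisfying a predicate, as an integer. -/
noncomputable def numSol (p : V → Prop) : ℤ := (Nat.card {v // p v} : ℤ)

theorem numSol_congr {p p' : V → Prop} (h : ∀ v, p v ↔ p' v) : numSol p = numSol p' := by
  rw [show p = p' from funext fun v => propext (h v)]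

theorem numSol_equiv (e : V ≃ W) (p : W → Prop) : numSol (fun v => p (e v)) = numSol p := by
  unfold numSol
  rw [Nat.card_congr (e.subtypeEquiv (p := fun v => p (e v)) (q := p) fun _ => Iff.rfl)]

theorem numSol_true : numSol (fun _ : V => True) = Nat.card V := by
  unfold numSol
  rw [Nat.card_congr (Equiv.subtypeUnivEquiv fun _ => trivial)]

open Classical in
theorem numSol_eq_sum [Fintype V] (p : V → Prop) : numSol p = ∑ v, if p v then 1 else 0 := by
  unfold numSol
  rw [Nat.card_eq_fintype_card, Fintype.card_subtype, Finset.card_filter]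
  push_cast
  rfl

theorem numSol_prod [Fintype V] [Fintype W] (p : V × W → Prop) :
    numSol p = ∑ w, numSol fun v => p (v, w) := by
  simp only [numSol_eq_sum, Fintype.sum_prod_type_right]

theorem numSol_and_add_and_not [Finite V] (p s : V → Prop) :
    numSol (fun v => p v ∧ s v) + numSol (fun v => p v ∧ ¬ s v) = numSol p := by
  classical
  have := Fintype.ofFinite V
  simp only [numSol_eq_sum, ← Finset.sum_add_distrib]
  refine Finset.sum_congr rfl fun v _ => ?_
  by_cases hp : p v <;> by_cases hs : s v <;> simp [hp, hs]

theorem numSol_add_not [Finite V] (s : V → Prop) :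
    numSol s + numSol (fun v => ¬ s v) = Nat.card V := by
  have := numSol_and_add_and_not (fun _ => True) s
  simpa only [true_and, numSol_true] using this

theorem numSol_eq_one {p : V → Prop} (a : V) (h : ∀ v, p v ↔ v = a) : numSol p = 1 := by
  unfold numSol
  have : Unique {v // p v} := ⟨⟨⟨a, (h a).2 rfl⟩⟩, fun v => Subtype.ext ((h v).1 v.2)⟩
  simp

theorem numSol_eq_zero {p : V → Prop} (h : ∀ v, ¬ p v) : numSol p = 0 := by
  unfold numSol
  have : IsEmpty {v // p v} := ⟨fun v => h v v.2⟩
  simp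

theorem exists_of_numSol_ne_zero {p : V → Prop} (h : numSol p ≠ 0) : ∃ v, p v := by
  by_contra! H
  exact h (numSol_eq_zero H)

theorem sum_comp_eq_sum_numSol [Fintype V] [Fintype F] (f : V → F) (h : F → ℤ) :
    ∑ v, h (f v) = ∑ c, numSol (fun v => f v = c) * h c := by
  classical
  simp only [numSol_eq_sum, Finset.sum_mul]
  rw [Finset.sum_comm]
  refine Finset.sum_congr rfl fun v _ => ?_
  simp

theorem sum_numSol_eq [Fintype V] [Fintype F] (f : V → F) :
    ∑ c, numSol (fun v => f v = c) = Nat.card V := by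
  have := sum_comp_eq_sum_numSol f fun _ => 1
  simpa using this.symm

end Counting

/-! ### Functions whose values are equidistributed outside zero -/

section Bias

variable {V W F : Type*} [Field F]

/-- A function `f : V → F` has bias `b` if it takes every nonzero value `(|V| - b) / |F|` times,
and the value `0` exactly `b` times more often. -/
structure HasBias (f : V → F) (b : ℤ) : Prop where
  ne_zero : ∀ c ≠ 0, (Nat.card F : ℤ) * numSol (fun v => f v = c) = Nat.card V - b
  zero : (Nat.card F : ℤ) * numSol (fun v => f v = 0) = Nat.card V - b + Nat.card F * b

/-- For fixed w the condition on v is f(v) = c - g(w), which is exceptional only when g(w) = c.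
Nothing is required of g, so a single square, which has no bias, can be added to a form. -/
theorem HasBias.numSol_add [Fintype V] [Fintype W] {f : V → F} {b : ℤ} (hf : HasBias f b) (g : W → F) (c : F) :
    (Nat.card F : ℤ) * numSol (fun p : V × W => f p.1 + g p.2 = c)
      = Nat.card W * (Nat.card V - b) + Nat.card F * b * numSol (fun w => g w = c) := by
  classical
  rw [numSol_prod, Finset.mul_sum, numSol_eq_sum (fun w => g w = c), Finset.mul_sum,
    Nat.card_eq_fintype_card (α := W), ← Finset.card_univ, ← nsmul_eq_mul, ← Finset.sum_const,
    ← Finset.sum_add_distrib]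
  refine Finset.sum_congr rfl fun w _ => ?_
  have h : ∀ v, f v + g w = c ↔ f v = c - g w := fun v => eq_sub_iff_add_eq.symm
  rw [numSol_congr h]
  by_cases hw : g w = c
  · rw [hw, sub_self, hf.zero]; simp
  · rw [hf.ne_zero _ (sub_ne_zero.2 (Ne.symm hw))]; simp [hw]

/-- The bias is the common value of the nontrivial additive character sums of f, so it is
multiplicative on direct sums. Here this is read off from the counts alone. -/
theorem HasBias.add [Fintype V] [Fintype W] {f : V → F} {g : W → F} {b b' : ℤ} (hf : HasBias f b) (hg : HasBias g b') :
    HasBias (fun p : V × W => f p.1 + g p.2) (b * b') := by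
  constructor
  · intro c hc
    rw [hf.numSol_add, Nat.card_prod]
    push_cast
    linear_combination b * hg.ne_zero c hc
  · rw [hf.numSol_add, Nat.card_prod]
    push_cast
    linear_combination b * hg.zero

theorem HasBias.equiv {f : W → F} {b : ℤ} (hf : HasBias f b) (e : V ≃ W) :
    HasBias (fun v => f (e v)) b := by
  constructor
  · intro c hc
    rw [numSol_equiv e fun w => f w = c, hf.ne_zero c hc, Nat.card_congr e]
  · rw [numSol_equiv e fun w => f w = 0, hf.zero, Nat.card_congr e]

theorem hasBias_of_unique [Unique V] : HasBias (fun _ : V => (0 : F)) 1 := by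
  constructor
  · intro c hc
    rw [numSol_eq_zero fun _ => hc.symm]; simp
  · rw [numSol_eq_one default fun v => by simp [Unique.eq_default v]]; simp

theorem HasBias.sum_fin [Fintype V] {f : V → F} {b : ℤ} (hf : HasBias f b) (m : ℕ) :
    HasBias (fun x : Fin m → V => ∑ i, f (x i)) (b ^ m) := by
  induction m with
  | zero => simpa using hasBias_of_unique (V := Fin 0 → V) (F := F)
  | succ m ih =>
    rw [pow_succ']
    have := (hf.add ih).equiv (Fin.consEquiv fun _ : Fin (m + 1) => V).symm
    simpa [Fin.consEquiv, Fin.sum_univ_succ, Fin.tail] using this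

end Bias

/-! ### Quadratic forms over finite fields -/

section Quadratic

variable {V F : Type*} [Field F] [AddCommGroup V] [Module F V]

theorem card_mul_numSol_linear [Fintype F] [Fintype V] {l : V →ₗ[F] F} (hl : l ≠ 0) (c : F) :
    (Nat.card F : ℤ) * numSol (fun v => l v = c) = Nat.card V := by
  obtain ⟨v₀, hv₀⟩ : ∃ v, l v ≠ 0 := by
    by_contra! h
    exact hl (LinearMap.ext h)
  have key : ∀ c', numSol (fun v => l v = c') = numSol (fun v => l v = c) := fun c' => by
    rw [← numSol_equiv (Equiv.addRight (((c' - c) / l v₀) • v₀)) fun v => l v = c']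
    refine numSol_congr fun v => ?_
    simp only [Equiv.coe_addRight, map_add, map_smul, smul_eq_mul, div_mul_cancel₀ _ hv₀]
    constructor <;> intro h <;> linear_combination h
  have h := sum_numSol_eq fun v => l v
  simpa [key] using h

open QuadraticMap (polar polar_smul_left polar_smul_right polar_add_right polar_comm)

variable (φ : QuadraticForm F V)

theorem apply_add_smul_of_isotropic {x : V} (hx : φ x = 0) (v : V) (t : F) :
    φ (v + t • x) = φ v + t * polar φ x v := by
  have := polar_smul_left φ t x v
  rw [QuadraticMap.map_add φ, QuadraticMap.map_smul, hx, polar_comm, this]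
  simp

theorem polar_self_of_isotropic {x : V} (hx : φ x = 0) : polar φ x x = 0 := by
  rw [QuadraticMap.polar_self, hx, smul_zero]

/-- Zeros of a quadratic form not orthogonal to a given isotropic vector. -/
theorem card_mul_numSol_of_isotropic {x : V} (hx : φ x = 0) :
    (Nat.card F : ℤ) * numSol (fun v => φ v = 0 ∧ polar φ x v ≠ 0)
      = numSol (fun v => polar φ x v ≠ 0) := by
  have hB : ∀ v (t : F), polar φ x (v + t • x) = polar φ x v := fun v t => by
    rw [polar_add_right, polar_smul_right, polar_self_of_isotropic φ hx, smul_zero, add_zero]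
  unfold numSol
  rw [← Nat.cast_mul, ← Nat.card_prod, Nat.cast_inj]
  -- The map (t, v) ↦ v + t x: along each line parallel to x and not orthogonal to it, φ is affine
  -- in t with nonzero slope, so it vanishes exactly once.
  refine Nat.card_congr (Equiv.ofBijective
    (fun p => ⟨p.2.1 + p.1 • x, show polar φ x (p.2.1 + p.1 • x) ≠ 0 by rw [hB]; exact p.2.2.2⟩) ⟨?_, ?_⟩)
  · rintro ⟨t, v, hv, hv'⟩ ⟨s, w, hw, hw'⟩ h
    simp only [Subtype.mk.injEq] at h
    have h1 : polar φ x v = polar φ x w := by rw [← hB v t, h, hB]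
    have h2 : φ (v + t • x) = φ (w + s • x) := by rw [h]
    rw [apply_add_smul_of_isotropic φ hx, apply_add_smul_of_isotropic φ hx, hv, hw, h1, zero_add,
      zero_add] at h2
    have h3 := mul_right_cancel₀ hw' h2
    subst h3
    simpa using h
  · rintro ⟨v, hv⟩
    refine ⟨⟨φ v / polar φ x v, v + (-(φ v / polar φ x v)) • x, ?_, by rwa [hB]⟩, ?_⟩
    · rw [apply_add_smul_of_isotropic φ hx]
      field_simp
      ring
    · ext
      simp

/-- Two values of a quadratic form with nondegenerate polar form agree equally often for every
form of a given dimension. -/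
theorem sum_sq_numSol [Fintype F] [Fintype V] (hφ : ∀ x ≠ 0, ∃ y, polar φ x y ≠ 0) :
    (Nat.card F : ℤ) * ∑ c, numSol (fun v => φ v = c) ^ 2
      = Nat.card F * Nat.card V + (Nat.card V - 1) * Nat.card V := by
  classical
  have h1 : ∑ c, numSol (fun v => φ v = c) ^ 2 = numSol (fun p : V × V => φ p.1 = φ p.2) := by
    rw [numSol_prod, sum_comp_eq_sum_numSol φ fun c => numSol fun v => φ v = c]
    simp [_root_.sq]
  have h2 : numSol (fun p : V × V => φ p.1 = φ p.2)
      = numSol (fun p : V × V => polar φ p.2 p.1 = - φ p.2) := by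
    -- Replacing the pair by (u + v, v) turns φ(u + v) = φ(v) into a linear condition on v for each
    -- u. It is equidistributed unless u = 0, where it is vacuous.
    let e : V × V ≃ V × V := ⟨fun p => (p.2 + p.1, p.1), fun p => (p.2, p.1 - p.2),
      fun p => by simp, fun p => by simp⟩
    rw [← numSol_equiv e fun p : V × V => φ p.1 = φ p.2]
    refine numSol_congr fun p => ?_
    change φ (p.2 + p.1) = φ p.1 ↔ _
    rw [QuadraticMap.map_add φ]
    constructor <;> intro h <;> linear_combination h
  have h3 : ∀ u : V, (Nat.card F : ℤ) * numSol (fun v => polar φ u v = - φ u)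
      = Nat.card V + if u = 0 then (Nat.card F * Nat.card V - Nat.card V : ℤ) else 0 := fun u => by
    by_cases hu : u = 0
    · subst hu
      simp [numSol_true]
    · have hl : φ.polarBilin u ≠ 0 := fun h => by
        obtain ⟨y, hy⟩ := hφ u hu
        exact hy (by simpa using LinearMap.congr_fun h y)
      simpa [hu] using card_mul_numSol_linear hl (- φ u)
  rw [h1, h2, numSol_prod, Finset.mul_sum]
  simp only [h3, Finset.sum_add_distrib]
  simp
  ring

/-- In a plane, x^⊥ has |F| elements and contains the line F x, hence equals it: this gives |F|
zeros. Off x^⊥ one vector in |F| is a zero, giving |F| - 1 more. -/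
theorem numSol_zero_of_isotropic [Fintype F] [Fintype V] (hφ : ∀ x ≠ 0, ∃ y, polar φ x y ≠ 0)
    (hV : Nat.card V = Nat.card F ^ 2) {x : V} (hx0 : x ≠ 0) (hx : φ x = 0) :
    numSol (fun v => φ v = 0) = 2 * Nat.card F - 1 := by
  have hq : (Nat.card F : ℤ) ≠ 0 := by simp
  have hl : φ.polarBilin x ≠ 0 := fun h => by
    obtain ⟨y, hy⟩ := hφ x hx0
    exact hy (by simpa using LinearMap.congr_fun h y)
  have hker : numSol (fun v => polar φ x v = 0) = Nat.card F := by
    have := card_mul_numSol_linear hl 0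
    rw [hV] at this
    push_cast at this
    exact mul_left_cancel₀ hq (this.trans (sq _))
  have h1 := numSol_add_not fun v => polar φ x v = 0
  have h2 := card_mul_numSol_of_isotropic φ hx
  have h3 := numSol_and_add_and_not (fun v => φ v = 0) fun v => polar φ x v = 0
  have h4 : numSol (fun v => φ v = 0 ∧ polar φ x v = 0) = Nat.card F := by
    rw [← hker]
    refine numSol_congr fun v => ⟨fun h => h.2, fun h => ⟨?_, h⟩⟩
    have hinj : Function.Injective fun t : F =>
        (⟨t • x, by rw [polar_smul_right, polar_self_of_isotropic φ hx, smul_zero]⟩ :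
          {v // polar φ x v = 0}) := fun t s h => by
      simpa [hx0] using h
    have hc : Nat.card F = Nat.card {v // polar φ x v = 0} := by
      exact Nat.cast_injective (R := ℤ) hker.symm
    obtain ⟨t, ht⟩ := ((Nat.bijective_iff_injective_and_card _).2 ⟨hinj, hc⟩).2 ⟨v, h⟩
    have : t • x = v := congrArg Subtype.val ht
    rw [← this, QuadraticMap.map_smul, hx, smul_zero]
  rw [hV, hker] at h1
  push_cast at h1
  apply mul_left_cancel₀ hq
  linear_combination (-(Nat.card F : ℤ)) * h3 + h2 + (Nat.card F : ℤ) * h4 + h1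

/-- The number of zeros fixes the first two moments of the remaining fibre sizes. With e² = 1 the
sum of their squared deviations from |F| - e is zero, so all nonzero values are taken equally often.
-/
theorem hasBias_of_numSol_zero [Fintype F] [Fintype V] (hφ : ∀ x ≠ 0, ∃ y, polar φ x y ≠ 0)
    (hV : Nat.card V = Nat.card F ^ 2) {e : ℤ} (he : e ^ 2 = 1)
    (h0 : numSol (fun v => φ v = 0) = Nat.card F + e * (Nat.card F - 1)) :
    HasBias φ (e * Nat.card F) := by
  classical
  have hq : (Nat.card F : ℤ) ≠ 0 := by simp
  have h1 := sum_numSol_eq φ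
  have h2 := sum_sq_numSol φ hφ
  rw [hV] at h1 h2
  rw [← Finset.add_sum_erase _ _ (Finset.mem_univ (0 : F)), h0] at h1 h2
  push_cast at h1 h2
  replace h2 : (Nat.card F : ℤ) * ∑ c ∈ Finset.univ.erase 0, numSol (fun v => φ v = c) ^ 2
      = Nat.card F * ((Nat.card F - 1) * (Nat.card F - e) ^ 2) := by
    linear_combination h2 - (Nat.card F : ℤ) ^ 2 * (Nat.card F - 1) * he
  replace h2 := mul_left_cancel₀ hq h2
  have hcard : ((Finset.univ.erase (0 : F)).card : ℤ) = Nat.card F - 1 := by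
    rw [Finset.card_erase_of_mem (Finset.mem_univ _), Finset.card_univ,
      ← Nat.card_eq_fintype_card, Nat.cast_sub Nat.card_pos, Nat.cast_one]
  have h3 : ∑ c ∈ Finset.univ.erase (0 : F),
      (numSol (fun v => φ v = c) - (Nat.card F - e)) ^ 2 = 0 := by
    simp only [sub_sq, Finset.sum_add_distrib, Finset.sum_sub_distrib, ← Finset.sum_mul,
      ← Finset.mul_sum, Finset.sum_const, nsmul_eq_mul, hcard]
    rw [h2]
    linear_combination (-2 * (Nat.card F - e) : ℤ) * h1
  constructor
  · intro c hc
    have := (Finset.sum_eq_zero_iff_of_nonneg fun c _ => sq_nonneg _).1 h3 c (by simp [hc])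
    rw [hV]
    push_cast
    linear_combination (Nat.card F : ℤ) * (pow_eq_zero_iff two_ne_zero).1 this
  · rw [h0, hV]
    push_cast
    ring

theorem hasBias_of_isotropic [Fintype F] [Fintype V] (hφ : ∀ x ≠ 0, ∃ y, polar φ x y ≠ 0)
    (hV : Nat.card V = Nat.card F ^ 2) {x : V} (hx0 : x ≠ 0) (hx : φ x = 0) :
    HasBias φ (Nat.card F) := by
  have := hasBias_of_numSol_zero φ hφ hV (one_pow 2)
    (by rw [numSol_zero_of_isotropic φ hφ hV hx0 hx]; ring)
  rwa [one_mul] at this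

theorem hasBias_of_anisotropic [Fintype F] [Fintype V] (hφ : ∀ x ≠ 0, ∃ y, polar φ x y ≠ 0)
    (hV : Nat.card V = Nat.card F ^ 2) (h : ∀ x, φ x = 0 → x = 0) :
    HasBias φ (-Nat.card F) := by
  have := hasBias_of_numSol_zero φ hφ hV (e := -1) (by norm_num) (by
    rw [numSol_eq_one 0 fun v => ⟨h v, fun hv => by rw [hv, QuadraticMap.map_zero]⟩]; ring)
  rwa [neg_one_mul] at this

end Quadratic

/-! ### Hyperplane sections of the cone over a sum of squares -/

section SumOfSquares

variable {K : Type*} [Field K]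

/-- The quadratic form `c x² + d y²`. -/
def binaryForm (c d : K) : QuadraticForm K (K × K) :=
  QuadraticMap.prod (c • QuadraticMap.sq) (d • QuadraticMap.sq)

theorem binaryForm_apply (c d : K) (p : K × K) : binaryForm c d p = c * p.1 ^ 2 + d * p.2 ^ 2 := by
  simp [binaryForm, pow_two]

theorem binaryForm_nondegenerate (h2 : (2 : K) ≠ 0) {c d : K} (hc : c ≠ 0) (hd : d ≠ 0) :
    ∀ x ≠ 0, ∃ y, QuadraticMap.polar (binaryForm c d) x y ≠ 0 := by
  have hB : ∀ x y, QuadraticMap.polar (binaryForm c d) x y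
      = 2 * (c * x.1 * y.1 + d * x.2 * y.2) := fun x y => by
    simp only [QuadraticMap.polar, binaryForm_apply, Prod.fst_add, Prod.snd_add]
    ring
  rintro ⟨x₁, x₂⟩ hx
  by_contra! h
  have h₁ := h (1, 0)
  have h₂ := h (0, 1)
  rw [hB] at h₁ h₂
  simp [h2, hc, hd] at h₁ h₂
  exact hx (by simp [h₁, h₂])

variable [Fintype K]

theorem hasBias_binary_isotropic (h2 : (2 : K) ≠ 0) {c d : K} (hc : c ≠ 0) (hd : d ≠ 0)
    {x : K × K} (hx0 : x ≠ 0) (hx : c * x.1 ^ 2 + d * x.2 ^ 2 = 0) :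
    HasBias (fun p : K × K => c * p.1 ^ 2 + d * p.2 ^ 2) (Nat.card K) := by
  have := hasBias_of_isotropic (binaryForm c d) (binaryForm_nondegenerate h2 hc hd)
    (by rw [Nat.card_prod, sq]) hx0 (by rw [binaryForm_apply, hx])
  rwa [funext (binaryForm_apply c d)] at this

theorem hasBias_binary_anisotropic (h2 : (2 : K) ≠ 0) {c d : K} (hc : c ≠ 0) (hd : d ≠ 0)
    (h : ∀ x : K × K, c * x.1 ^ 2 + d * x.2 ^ 2 = 0 → x = 0) :
    HasBias (fun p : K × K => c * p.1 ^ 2 + d * p.2 ^ 2) (-Nat.card K) := by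
  have := hasBias_of_anisotropic (binaryForm c d) (binaryForm_nondegenerate h2 hc hd)
    (by rw [Nat.card_prod, sq]) fun x hx => h x (by rw [← binaryForm_apply, hx])
  rwa [funext (binaryForm_apply c d)] at this

/-- The form x² - d y² is isotropic exactly when d is a square; e records this square class. -/
theorem exists_hasBias_sq_sub_mul_sq (h2 : (2 : K) ≠ 0) {d : K} (hd : d ≠ 0) :
    ∃ e : ℤ, ((IsSquare d ∧ e = 1) ∨ (¬ IsSquare d ∧ e = -1)) ∧
      HasBias (fun p : K × K => 1 * p.1 ^ 2 + -d * p.2 ^ 2) (e * Nat.card K) := by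
  by_cases hs : IsSquare d
  · refine ⟨1, Or.inl ⟨hs, rfl⟩, ?_⟩
    obtain ⟨s, rfl⟩ := hs
    rw [one_mul]
    refine hasBias_binary_isotropic h2 one_ne_zero (neg_ne_zero.2 hd) (x := (s, 1)) (by simp) ?_
    ring
  · refine ⟨-1, Or.inr ⟨hs, rfl⟩, ?_⟩
    rw [neg_one_mul]
    refine hasBias_binary_anisotropic h2 one_ne_zero (neg_ne_zero.2 hd) ?_
    rintro ⟨x, y⟩ h
    simp only at h
    by_cases hy : y = 0
    · subst hy
      simpa using h
    · refine absurd ⟨x / y, ?_⟩ hs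
      field_simp
      linear_combination -h

/-- Splitting off the first coordinate of a vector. -/
def finConsEquiv (K : Type*) (m : ℕ) : (Fin (m + 1) → K) ≃ (Fin m → K) × K :=
  (Fin.consEquiv fun _ : Fin (m + 1) => K).symm.trans (Equiv.prodComm _ _)

omit [Fintype K] in
theorem sum_finConsEquiv {m : ℕ} (g : K → K) (x : Fin (m + 1) → K) :
    ∑ i, g (x i) = ∑ i, g ((finConsEquiv K m x).1 i) + g (finConsEquiv K m x).2 := by
  rw [Fin.sum_univ_succ, add_comm]
  rfl

/-- Since (1, i) is isotropic, x² + y² is a hyperbolic plane of bias |K|, and 2k squares make k such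
planes. -/
theorem hasBias_sum_sq (h2 : (2 : K) ≠ 0) {i : K} (hi : i ^ 2 = -1) (k : ℕ) :
    HasBias (fun x : Fin (2 * k) → K => ∑ j, x j ^ 2) ((Nat.card K : ℤ) ^ k) := by
  induction k with
  | zero => simpa using hasBias_of_unique (V := Fin 0 → K) (F := K)
  | succ k ih =>
    have hb := hasBias_binary_isotropic h2 one_ne_zero one_ne_zero (x := ((1 : K), i))
      (by simp) (by simp [hi])
    have := (ih.add hb).equiv (((finConsEquiv K (2 * k + 1)).trans
      ((finConsEquiv K (2 * k)).prodCongr (Equiv.refl K))).trans (Equiv.prodAssoc _ _ _))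
    rw [pow_succ]
    change HasBias (fun x : Fin (2 * k + 1 + 1) → K => ∑ j, x j ^ 2) _
    convert this using 1
    funext x
    rw [sum_finConsEquiv (· ^ 2), sum_finConsEquiv (· ^ 2)]
    simp only [Equiv.trans_apply, Equiv.prodCongr_apply, Equiv.prodAssoc_apply, Prod.map_fst,
      Prod.map_snd, Equiv.refl_apply]
    ring

omit [Fintype K] in
theorem numSol_sq_mul {d : K} (hd : d ≠ 0) : numSol (fun t : K => d * t ^ 2 = 0) = 1 :=
  numSol_eq_one 0 fun v => by simp [hd]

theorem numSol_sum_sq_even (h2 : (2 : K) ≠ 0) {i : K} (hi : i ^ 2 = -1) (k : ℕ) :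
    (Nat.card K : ℤ) * numSol (fun x : Fin (2 * k) → K => ∑ j, x j ^ 2 = 0)
      = (Nat.card K : ℤ) ^ (2 * k) - (Nat.card K : ℤ) ^ k + (Nat.card K : ℤ) ^ (k + 1) := by
  rw [(hasBias_sum_sq h2 hi k).zero, Nat.card_fun, Nat.card_fin]
  push_cast
  ring

/-- The extra square vanishes for just one t, which is the average frequency of a value in K, so the
bias of the other 2k squares cancels. -/
theorem numSol_sum_sq_odd (h2 : (2 : K) ≠ 0) {i : K} (hi : i ^ 2 = -1) (k : ℕ) :
    numSol (fun x : Fin (2 * k + 1) → K => ∑ j, x j ^ 2 = 0) = (Nat.card K : ℤ) ^ (2 * k) := by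
  have hQ : (Nat.card K : ℤ) ≠ 0 := by simp
  have h := (hasBias_sum_sq h2 hi k).numSol_add (fun t : K => 1 * t ^ 2) 0
  rw [numSol_sq_mul one_ne_zero, Nat.card_fun, Nat.card_fin,
    ← numSol_equiv (finConsEquiv K (2 * k))] at h
  simp only [one_mul] at h
  simp only [sum_finConsEquiv (· ^ 2)]
  push_cast at h
  apply mul_left_cancel₀ hQ
  linear_combination h

/-- The quadratic form `∑ x_i²`. -/
def sumSqForm (K : Type*) [Field K] (m : ℕ) : QuadraticForm K (Fin m → K) :=
  QuadraticMap.pi fun _ => QuadraticMap.sq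

omit [Fintype K] in
theorem sumSqForm_apply {m : ℕ} (x : Fin m → K) : sumSqForm K m x = ∑ j, x j ^ 2 := by
  simp [sumSqForm, pow_two]

omit [Fintype K] in
theorem polar_sumSqForm {m : ℕ} (x y : Fin m → K) :
    QuadraticMap.polar (sumSqForm K m) x y = 2 * ∑ j, x j * y j := by
  simp only [QuadraticMap.polar, sumSqForm_apply, Pi.add_apply, ← Finset.sum_sub_distrib,
    Finset.mul_sum]
  exact Finset.sum_congr rfl fun j _ => by ring

theorem card_mul_numSol_dot {m : ℕ} {b : Fin m → K} (hb : b ≠ 0) (c : K) :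
    (Nat.card K : ℤ) * numSol (fun x : Fin m → K => ∑ j, b j * x j = c)
      = (Nat.card K : ℤ) ^ m := by
  classical
  have hl : dotProductBilin K K b ≠ 0 := fun h => hb <| by
    ext j
    simpa using LinearMap.congr_fun h (Pi.single j 1)
  have := card_mul_numSol_linear hl c
  rw [Nat.card_fun, Nat.card_fin, Nat.cast_pow] at this
  simpa [dotProduct] using this

/-- Up to the factor 2, the functional x ↦ ∑ b_j x_j is the polar form at the isotropic vector b, so
one in |K| of the vectors off b^⊥ is a zero. -/
theorem numSol_isotropic_section (h2 : (2 : K) ≠ 0) {m : ℕ} {b : Fin m → K} (hb : b ≠ 0)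
    (h : ∑ j, b j ^ 2 = 0) :
    (Nat.card K : ℤ) ^ 2 * numSol (fun x : Fin m → K => ∑ j, x j ^ 2 = 0 ∧ ∑ j, b j * x j ≠ 0)
      = (Nat.card K - 1) * (Nat.card K : ℤ) ^ m := by
  have h1 := card_mul_numSol_of_isotropic (sumSqForm K m) (x := b) (by rw [sumSqForm_apply, h])
  simp only [polar_sumSqForm, sumSqForm_apply, ne_eq, mul_eq_zero, h2, false_or] at h1
  have h3 := numSol_add_not fun x : Fin m → K => ∑ j, b j * x j = 0
  have h4 := card_mul_numSol_dot hb 0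
  rw [Nat.card_fun, Nat.card_fin] at h3
  push_cast at h3
  linear_combination (Nat.card K : ℤ) * h1 + (Nat.card K : ℤ) * h3 - h4

/-- Counting the zeros of the sum of squares on the orthogonal complement of an anisotropic vector
by adding a hyperbolic plane. -/
theorem numSol_orthogonal (h2 : (2 : K) ≠ 0) {m : ℕ} {b : Fin m → K} {d : K}
    (h : ∑ j, b j ^ 2 = d) (hd : d ≠ 0) :
    (Nat.card K : ℤ) ^ 2 * numSol (fun p : (Fin m → K) × K => ∑ j, p.1 j ^ 2 + -d * p.2 ^ 2 = 0)
      = (Nat.card K : ℤ) ^ m * (Nat.card K ^ 2 - Nat.card K) + (Nat.card K : ℤ) ^ 3 *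
        numSol (fun x : Fin m → K => ∑ j, x j ^ 2 = 0 ∧ ∑ j, b j * x j = 0) := by
  classical
  have hb : b ≠ 0 := by
    rintro rfl
    exact hd (by simp [← h])
  let U := {x : Fin m → K // ∑ j, b j * x j = 0}
  have hU : (Nat.card K : ℤ) * Nat.card U = (Nat.card K : ℤ) ^ m := card_mul_numSol_dot hb 0
  have hdot : ∀ (x : Fin m → K) (t : K), ∑ j, b j * (x j + t * b j) = ∑ j, b j * x j + t * d := by
    intro x t
    rw [← h, Finset.mul_sum, ← Finset.sum_add_distrib]
    exact Finset.sum_congr rfl fun j _ => by ring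
  have hsq : ∀ (x : U) (t : K), ∑ j, (x.1 j + t * b j) ^ 2 = ∑ j, x.1 j ^ 2 + d * t ^ 2 := by
    intro x t
    have : ∑ j, (x.1 j + t * b j) ^ 2
        = ∑ j, x.1 j ^ 2 + 2 * t * ∑ j, b j * x.1 j + t ^ 2 * ∑ j, b j ^ 2 := by
      rw [Finset.mul_sum, Finset.mul_sum, ← Finset.sum_add_distrib, ← Finset.sum_add_distrib]
      exact Finset.sum_congr rfl fun j _ => by ring
    rw [this, x.2, h]
    ring
  -- As d ≠ 0, K^m is the orthogonal sum of K b and U = b^⊥. With the extra coordinate, the form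
  -- becomes the hyperbolic plane d s² - d t² plus the sum of squares on U.
  let e : (K × K) × U ≃ (Fin m → K) × K :=
    { toFun := fun p => (fun j => p.2.1 j + p.1.1 * b j, p.1.2)
      invFun := fun p => (((∑ j, b j * p.1 j) / d, p.2),
        ⟨fun j => p.1 j + -((∑ j, b j * p.1 j) / d) * b j, by rw [hdot]; field_simp; ring⟩)
      left_inv := by
        rintro ⟨⟨s, t⟩, x, hx⟩
        have : (∑ j, b j * (x j + s * b j)) / d = s := by
          rw [hdot, hx, zero_add, mul_div_cancel_right₀ _ hd]
        simp [this]
      right_inv := by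
        rintro ⟨x, t⟩
        simp }
  have hM : numSol (fun x : Fin m → K => ∑ j, x j ^ 2 = 0 ∧ ∑ j, b j * x j = 0)
      = numSol (fun x : U => ∑ j, x.1 j ^ 2 = 0) := by
    exact congrArg Nat.cast (Nat.card_congr ((Equiv.subtypeSubtypeEquivSubtypeInter
      (fun x : Fin m → K => ∑ j, b j * x j = 0) fun x => ∑ j, x j ^ 2 = 0).trans
      (Equiv.subtypeEquivRight fun x => and_comm))).symm
  have hb2 := hasBias_binary_isotropic h2 hd (neg_ne_zero.2 hd) (x := ((1 : K), (1 : K)))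
    (by simp) (by simp)
  have key := hb2.numSol_add (fun x : U => ∑ j, x.1 j ^ 2) 0
  rw [Nat.card_prod] at key
  rw [← numSol_equiv e, hM]
  have hc : ∀ p : (K × K) × U, (∑ j, (e p).1 j ^ 2 + -d * (e p).2 ^ 2 = 0) ↔
      d * p.1.1 ^ 2 + -d * p.1.2 ^ 2 + ∑ j, p.2.1 j ^ 2 = 0 := fun p => by
    change (∑ j, (p.2.1 j + p.1.1 * b j) ^ 2 + -d * p.1.2 ^ 2 = 0) ↔ _
    rw [hsq]
    constructor <;> intro h <;> linear_combination h
  rw [numSol_congr hc]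
  push_cast at key
  linear_combination (Nat.card K : ℤ) * key + (Nat.card K ^ 2 - Nat.card K : ℤ) * hU

/-- Here adding -d t² to 2k squares gives an odd number of variables, whose zero count does not see
the square class of d = ∑ b_j². -/
theorem numSol_anisotropic_section_even (h2 : (2 : K) ≠ 0) {i : K} (hi : i ^ 2 = -1) {k : ℕ}
    {b : Fin (2 * k) → K} (hd : ∑ j, b j ^ 2 ≠ 0) :
    (Nat.card K : ℤ) ^ 2 *
        numSol (fun x : Fin (2 * k) → K => ∑ j, x j ^ 2 = 0 ∧ ∑ j, b j * x j ≠ 0)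
      = (Nat.card K - 1) * ((Nat.card K : ℤ) ^ (2 * k) + (Nat.card K : ℤ) ^ (k + 1)) := by
  have hQ : (Nat.card K : ℤ) ≠ 0 := by simp
  have h1 := numSol_orthogonal h2 (b := b) rfl hd
  have h3 := (hasBias_sum_sq h2 hi k).numSol_add (fun t : K => -(∑ j, b j ^ 2) * t ^ 2) 0
  rw [numSol_sq_mul (neg_ne_zero.2 hd), Nat.card_fun, Nat.card_fin] at h3
  have h4 := numSol_sum_sq_even h2 hi k
  have h5 := numSol_and_add_and_not (fun x : Fin (2 * k) → K => ∑ j, x j ^ 2 = 0)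
    fun x => ∑ j, b j * x j = 0
  push_cast at h3
  apply mul_left_cancel₀ hQ
  linear_combination (Nat.card K : ℤ) ^ 3 * h5 + (Nat.card K : ℤ) ^ 2 * h4 + h1 -
    (Nat.card K : ℤ) * h3

/-- Adding -d t² to 2k + 1 squares leaves k hyperbolic planes and the binary form x² - d y², whose
type is governed by the square class of d. -/
theorem numSol_anisotropic_section_odd (h2 : (2 : K) ≠ 0) {i : K} (hi : i ^ 2 = -1) {k : ℕ}
    {b : Fin (2 * k + 1) → K} {d : K} (h : ∑ j, b j ^ 2 = d) (hd : d ≠ 0) :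
    ∃ e : ℤ, ((IsSquare d ∧ e = 1) ∨ (¬ IsSquare d ∧ e = -1)) ∧
    (Nat.card K : ℤ) ^ 2 *
        numSol (fun x : Fin (2 * k + 1) → K => ∑ j, x j ^ 2 = 0 ∧ ∑ j, b j * x j ≠ 0)
      = (Nat.card K - 1) * ((Nat.card K : ℤ) ^ (2 * k + 1) - e * (Nat.card K : ℤ) ^ (k + 1)) := by
  have hQ : (Nat.card K : ℤ) ≠ 0 := by simp
  obtain ⟨e, he, hbias⟩ := exists_hasBias_sq_sub_mul_sq h2 hd
  refine ⟨e, he, ?_⟩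
  have h1 := numSol_orthogonal h2 h hd
  have h3 := ((hasBias_sum_sq h2 hi k).add hbias).zero
  rw [← numSol_equiv (((finConsEquiv K (2 * k)).prodCongr (Equiv.refl K)).trans
    (Equiv.prodAssoc _ _ _))] at h3
  have hc : ∀ p : (Fin (2 * k + 1) → K) × K,
      (∑ j, (((finConsEquiv K (2 * k)).prodCongr (Equiv.refl K)).trans
        (Equiv.prodAssoc _ _ _) p).1 j ^ 2 +
      (1 * (((finConsEquiv K (2 * k)).prodCongr (Equiv.refl K)).trans
        (Equiv.prodAssoc _ _ _) p).2.1 ^ 2 +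
      -d * (((finConsEquiv K (2 * k)).prodCongr (Equiv.refl K)).trans
        (Equiv.prodAssoc _ _ _) p).2.2 ^ 2) = 0) ↔ ∑ j, p.1 j ^ 2 + -d * p.2 ^ 2 = 0 := fun p => by
    rw [sum_finConsEquiv (· ^ 2)]
    simp only [Equiv.trans_apply, Equiv.prodCongr_apply, Equiv.prodAssoc_apply, Prod.map_fst,
      Prod.map_snd, Equiv.refl_apply, one_mul, add_assoc]
  rw [numSol_congr hc, Nat.card_prod, Nat.card_prod, Nat.card_fun, Nat.card_fin] at h3
  have h4 := numSol_sum_sq_odd h2 hi k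
  have h5 := numSol_and_add_and_not (fun x : Fin (2 * k + 1) → K => ∑ j, x j ^ 2 = 0)
    fun x => ∑ j, b j * x j = 0
  push_cast at h3
  apply mul_left_cancel₀ hQ
  linear_combination (Nat.card K : ℤ) ^ 3 * h5 + (Nat.card K : ℤ) ^ 3 * h4 + h1 -
    (Nat.card K : ℤ) * h3

end SumOfSquares

/-! ### Quadratic forms attached to an involution -/

section Involution

variable {K : Type*} [Field K] {F : Subfield K}

/-- `σ` is an involution of `K` with fixed field `F`. -/
structure IsConj (σ : K →ₐ[F] K) : Prop where
  apply_apply : ∀ x, σ (σ x) = x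
  mem : ∀ x, σ x = x → x ∈ F

variable {σ : K →ₐ[F] K} (hσ : IsConj σ)

theorem apply_coe (σ : K →ₐ[F] K) (a : F) : σ (a : K) = a := σ.commutes a

/-- The quadratic form `x σ(x) + μ x² + σ(μ x²)` over the fixed field. -/
def conjForm (hσ : IsConj σ) (μ : K) : QuadraticForm F K :=
  QuadraticMap.ofPolar
    (fun x => ⟨x * σ x + μ * x ^ 2 + σ (μ * x ^ 2),
      hσ.mem _ (by simp only [map_add, map_mul, map_pow, hσ.apply_apply]; ring)⟩)
    (fun a x => Subtype.ext (by
      change (a • x) * σ (a • x) + μ * (a • x) ^ 2 + σ (μ * (a • x) ^ 2)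
        = (a * a : K) * (x * σ x + μ * x ^ 2 + σ (μ * x ^ 2))
      simp only [map_mul, map_pow, Subfield.smul_def, smul_eq_mul, apply_coe]
      ring))
    (fun x x' y => Subtype.ext (by
      simp only [QuadraticMap.polar, map_add, map_mul, map_pow, AddSubgroupClass.coe_sub,
        Subfield.coe_add]
      ring))
    (fun a x y => Subtype.ext (by
      simp only [QuadraticMap.polar, map_add, map_mul, map_pow, Subfield.smul_def, apply_coe,
        smul_eq_mul, AddSubgroupClass.coe_sub, Subfield.coe_mul]
      ring))

theorem coe_conjForm (μ x : K) :
    (conjForm hσ μ x : K) = x * σ x + μ * x ^ 2 + σ (μ * x ^ 2) := rfl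

theorem coe_polar_conjForm (μ x y : K) :
    ((QuadraticMap.polar (conjForm hσ μ) x y : F) : K)
      = y * (σ x + 2 * μ * x) + σ (y * (σ x + 2 * μ * x)) := by
  simp only [QuadraticMap.polar, AddSubgroupClass.coe_sub, coe_conjForm, map_add, map_mul, map_pow,
    hσ.apply_apply, map_ofNat]
  ring

-- Conjugating the relation σ(x) = -2μx and eliminating σ(x) gives (4μσ(μ) - 1)x = 0.
include hσ in
theorem conj_add_mul_ne_zero {μ : K} (hμ : 4 * (μ * σ μ) ≠ 1) {x : K} (hx : x ≠ 0) :
    σ x + 2 * μ * x ≠ 0 := by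
  intro h
  have h' : σ (σ x + 2 * μ * x) = 0 := by rw [h, map_zero]
  simp only [map_add, map_mul, hσ.apply_apply, map_ofNat] at h'
  have : (4 * (μ * σ μ) - 1) * x = 0 := by linear_combination 2 * σ μ * h - h'
  exact (mul_ne_zero (sub_ne_zero.2 hμ) hx) this

theorem conjForm_nondegenerate (h2 : (2 : K) ≠ 0) {μ : K} (hμ : 4 * (μ * σ μ) ≠ 1) :
    ∀ x ≠ 0, ∃ y, QuadraticMap.polar (conjForm hσ μ) x y ≠ 0 := by
  intro x hx
  have hc := conj_add_mul_ne_zero hσ hμ hx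
  -- The polar form is the trace of y (σ(x) + 2μx); this y makes it the trace of 1, which is 2.
  refine ⟨(σ x + 2 * μ * x)⁻¹, fun h => h2 ?_⟩
  have := congrArg Subtype.val h
  rw [coe_polar_conjForm, inv_mul_cancel₀ hc, map_one] at this
  simpa [one_add_one_eq_two] using this

/-- A zero x ≠ 0 gives u = σ(x)/x with σ(μ)u² + u + μ = 0, of discriminant e², so s = 2σ(μ)u lies in
F. Since u has norm 1, s² = 4μσ(μ). Then (s + 1)² = e² = 1 - s² leaves s = 0, excluded by μ ≠ 0, or
s = -1, excluded by e ≠ 0. -/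
theorem conjForm_anisotropic (h2 : (2 : K) ≠ 0) {μ : K} (hμ : μ ≠ 0) {e : F} (he : e ≠ 0)
    (h : 1 - 4 * (μ * σ μ) = (e : K) ^ 2) (x : K) (hx : conjForm hσ μ x = 0) : x = 0 := by
  by_contra hx0
  have hμ' : σ μ ≠ 0 := by simpa using hμ
  have hx0' : σ x ≠ 0 := by simpa using hx0
  have hx' := congrArg Subtype.val hx
  rw [coe_conjForm, map_mul, map_pow, Subfield.coe_zero] at hx'
  have he' : (e : K) ≠ 0 := by simpa using he
  have hsq : (2 * σ μ * (σ x / x) + 1) ^ 2 = (e : K) ^ 2 := by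
    rw [← h]
    field_simp
    linear_combination 4 * σ μ * hx'
  obtain ⟨s, hs1, hs⟩ : ∃ s : F, ((s : K) + 1) ^ 2 = (e : K) ^ 2 ∧ 2 * σ μ * (σ x / x) = s := by
    rcases sq_eq_sq_iff_eq_or_eq_neg.1 hsq with h | h
    · exact ⟨e - 1, by push_cast; ring, by push_cast; linear_combination h⟩
    · exact ⟨-e - 1, by push_cast; ring, by push_cast; linear_combination h⟩
  have hs' : 2 * μ * (x / σ x) = s := by
    have := congrArg σ hs
    simpa only [map_mul, map_div₀, map_ofNat, hσ.apply_apply, apply_coe] using this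
  have hN : 4 * (μ * σ μ) = (s : K) ^ 2 := by
    rw [sq]
    nth_rw 1 [← hs]
    rw [← hs']
    field_simp
    ring
  have h3 : (s : K) * (s + 1) = 0 := by
    apply mul_left_cancel₀ h2
    linear_combination hs1 - h - hN
  have hs0 : (s : K) ≠ 0 := fun h0 => by
    rw [h0] at hN
    have h4 : (4 : K) ≠ 0 := by
      rw [show (4 : K) = 2 * 2 by norm_num]
      exact mul_ne_zero h2 h2
    simp [h4, hμ] at hN
  have h4 : (s : K) + 1 = 0 := (mul_eq_zero.1 h3).resolve_left hs0
  rw [h4] at hs1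
  exact he' (by simpa using hs1.symm)

variable [Fintype K]

/-- The sign e is pinned down only when the discriminant is a square; elsewhere only an even power
of e is used. -/
theorem exists_hasBias_conjForm (h2 : (2 : K) ≠ 0) (hK : Nat.card K = Nat.card F ^ 2) {μ : K}
    (hμ0 : μ ≠ 0) (hμ : 4 * (μ * σ μ) ≠ 1) :
    ∃ e : ℤ, e ^ 2 = 1 ∧ ((∃ d : F, 1 - 4 * (μ * σ μ) = (d : K) ^ 2) → e = -1) ∧
      HasBias (conjForm hσ μ) (e * Nat.card F) := by
  classical
  have := Fintype.ofFinite F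
  have hnd := conjForm_nondegenerate hσ h2 hμ
  by_cases h : ∀ x, conjForm hσ μ x = 0 → x = 0
  · refine ⟨-1, by norm_num, fun _ => rfl, ?_⟩
    rw [neg_one_mul]
    exact hasBias_of_anisotropic _ hnd hK h
  · refine ⟨1, by norm_num, ?_, ?_⟩
    · rintro ⟨d, hd⟩
      refine absurd (conjForm_anisotropic hσ h2 hμ0 (e := d) ?_ hd) h
      rintro rfl
      apply hμ
      rw [Subfield.coe_zero] at hd
      linear_combination -hd
    · push Not at h
      obtain ⟨x, hx, hx0⟩ := h
      rw [one_mul]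
      exact hasBias_of_isotropic _ hnd hK hx0 hx

/-- The function `∑ (β x_i σ(x_i) - α x_i²)`, which parametrizes the affine points: they are the
points with `x_r ∈ h(x) + F`. -/
def affineSection (σ : K →ₐ[F] K) (α β : K) {m : ℕ} (x : Fin m → K) : K :=
  ∑ i, (β * (x i * σ (x i)) - α * x i ^ 2)

-- Once x is fixed there is at most one t in F, and it exists exactly when c₀ + ∑ c_i x_i + h(x) is
-- fixed by σ. The clause on c = 0 is what later shows that both k = 0 and k ≠ 0 occur.
include hσ in
theorem numSol_affine_hyperplane {α β : K} (hβ : β ∉ F)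
    (hμ : 4 * (α / (σ β - β) * σ (α / (σ β - β))) ≠ 1) {m : ℕ} (c₀ : K) (c : Fin m → K) :
    ∃ k : F, (c = 0 → (k = 0 ↔ c₀ ∈ F)) ∧
      numSol (fun p : F × (Fin m → K) =>
        c₀ + ∑ i, c i * p.2 i + (affineSection σ α β p.2 + p.1) = 0)
      = numSol (fun x : Fin m → K => ∑ i, conjForm hσ (α / (σ β - β)) (x i) = k) := by
  classical
  have hγ : σ β - β ≠ 0 := fun h => hβ (hσ.mem _ (sub_eq_zero.1 h))
  have hσγ : σ (σ β - β) = -(σ β - β) := by rw [map_sub, hσ.apply_apply]; ring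
  set γ := σ β - β with hγdef
  set μ := α / γ with hμdef
  have hα : α = μ * γ := by rw [hμdef, div_mul_cancel₀ _ hγ]
  have hinj : Function.Injective fun y : K => σ y + 2 * μ * y := fun y z h => by
    by_contra hyz
    refine conj_add_mul_ne_zero hσ hμ (sub_ne_zero.2 hyz) ?_
    rw [map_sub]
    linear_combination h
  -- Completing the square: these y_i make γ times the polar form of y_i and x_i equal to σ(c_i x_i)
  -- - c_i x_i, so translating by y absorbs the linear part.
  choose y hy using fun i => (Finite.surjective_of_injective hinj) (-(c i / γ))
  simp only at hy
  have hc₀ : (σ c₀ - c₀) / γ ∈ F := hσ.mem _ (by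
    rw [map_div₀, hσγ, map_sub, hσ.apply_apply, div_neg, ← neg_div, neg_sub])
  refine ⟨∑ i, conjForm hσ μ (y i) - ⟨_, hc₀⟩, ?_, ?_⟩
  · rintro rfl
    have hy0 : ∀ i, y i = 0 := fun i => hinj (by simp [hy])
    simp only [hy0, QuadraticMap.map_zero, Finset.sum_const_zero, zero_sub, neg_eq_zero]
    rw [← Subtype.val_inj]
    simp only [Subfield.coe_zero, div_eq_zero_iff, hγ, or_false, sub_eq_zero]
    exact ⟨hσ.mem _, fun h => apply_coe σ ⟨_, h⟩⟩
  · have h1 : ∀ x : Fin m → K, numSol (fun t : F =>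
        c₀ + ∑ i, c i * x i + (affineSection σ α β x + t) = 0)
        = if c₀ + ∑ i, c i * x i + affineSection σ α β x ∈ F then 1 else 0 := fun x => by
      split_ifs with h
      · refine numSol_eq_one (-⟨_, h⟩) fun t => ?_
        rw [← Subtype.val_inj, Subfield.coe_neg]
        constructor <;> intro h <;> linear_combination h
      · refine numSol_eq_zero fun t ht => h ?_
        rw [show c₀ + ∑ i, c i * x i + affineSection σ α β x = ((-t : F) : K) by
          rw [Subfield.coe_neg]; linear_combination ht]
        exact (-t).2
    have := Fintype.ofFinite F
    rw [numSol_prod]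
    simp only [h1]
    rw [← numSol_eq_sum, ← numSol_equiv (Equiv.addRight y) fun x : Fin m → K =>
      ∑ i, conjForm hσ μ (x i) = _]
    refine numSol_congr fun x => ?_
    have h2 : c₀ + ∑ i, c i * x i + affineSection σ α β x ∈ F ↔
        σ (c₀ + ∑ i, c i * x i + affineSection σ α β x)
          - (c₀ + ∑ i, c i * x i + affineSection σ α β x) = 0 :=
      ⟨fun h => sub_eq_zero.2 (apply_coe σ ⟨_, h⟩), fun h => hσ.mem _ (sub_eq_zero.1 h)⟩
    have h3 : σ (c₀ + ∑ i, c i * x i + affineSection σ α β x)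
          - (c₀ + ∑ i, c i * x i + affineSection σ α β x)
        = γ * ((∑ i, conjForm hσ μ (x i + y i)
          - (∑ i, conjForm hσ μ (y i) - ⟨_, hc₀⟩) : F) : K) := by
      have h4 : ∀ i, σ (c i * x i) - c i * x i + (σ (β * (x i * σ (x i)) - α * x i ^ 2)
          - (β * (x i * σ (x i)) - α * x i ^ 2))
          = γ * (conjForm hσ μ (x i + y i) - conjForm hσ μ (y i) : F) := fun i => by
        have hci : c i = -(γ * (σ (y i) + 2 * μ * y i)) := by
          rw [hy i]; field_simp
        have hB := coe_polar_conjForm hσ μ (y i) (x i)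
        have h5 : (conjForm hσ μ (x i + y i) - conjForm hσ μ (y i) : F)
            = conjForm hσ μ (x i) + QuadraticMap.polar (conjForm hσ μ) (y i) (x i) := by
          rw [QuadraticMap.polar, add_comm (x i)]
          ring
        rw [h5, Subfield.coe_add, hB, coe_conjForm, hci, hα]
        simp only [map_add, map_sub, map_mul, map_pow, map_neg, hσ.apply_apply, hσγ, map_ofNat]
        have : σ β = γ + β := by rw [hγdef]; ring
        rw [this]
        ring
      have h5 : (∑ i, conjForm hσ μ (x i + y i) - (∑ i, conjForm hσ μ (y i) - ⟨_, hc₀⟩) : F)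
          = ∑ i, (conjForm hσ μ (x i + y i) - conjForm hσ μ (y i)) + ⟨_, hc₀⟩ := by
        rw [Finset.sum_sub_distrib]
        ring
      rw [h5, Subfield.coe_add, AddSubmonoidClass.coe_finsetSum, mul_add, Finset.mul_sum,
        ← Finset.sum_congr rfl fun i _ => h4 i, mul_div_cancel₀ _ hγ, affineSection]
      rw [map_add, map_add, map_sum, map_sum]
      simp only [Finset.sum_add_distrib, Finset.sum_sub_distrib]
      ring
    rw [h2, h3, mul_eq_zero, or_iff_right hγ, ← Subfield.coe_zero, Subtype.val_inj, sub_eq_zero]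
    rfl

end Involution

/-! ### The conjugation of `GF(q²)` over `GF(q)` -/

section Frobenius

variable {K : Type*} [Field K] [Fintype K] {F : Subfield K} {q : ℕ}

/-- The q elements of F already exhaust the roots of X^q - X. -/
theorem mem_subfield_of_pow_card_eq (hF : Nat.card F = q) {x : K} (hx : x ^ q = x) : x ∈ F := by
  classical
  have := Fintype.ofFinite F
  by_contra hxF
  have hq : 1 < q := hF ▸ Finite.one_lt_card
  have hdeg : (Polynomial.X ^ q - Polynomial.X : Polynomial K).natDegree = q :=
    FiniteField.X_pow_card_sub_X_natDegree_eq K hq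
  have hne : (Polynomial.X ^ q - Polynomial.X : Polynomial K) ≠ 0 :=
    FiniteField.X_pow_card_sub_X_ne_zero K hq
  have hmem : ∀ y ∈ F, y ^ q = y := fun y hy => by
    have := FiniteField.pow_card (⟨y, hy⟩ : F)
    rw [← Nat.card_eq_fintype_card, hF] at this
    exact congrArg Subtype.val this
  have hle := Polynomial.card_le_degree_of_subset_roots
    (p := (Polynomial.X ^ q - Polynomial.X : Polynomial K))
    (Z := insert x (Finset.univ.map (Function.Embedding.subtype (· ∈ F)))) (by
      intro y hy
      rw [Finset.mem_val, Finset.mem_insert] at hy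
      rw [Polynomial.mem_roots hne]
      simp only [Finset.mem_map, Finset.mem_univ, true_and] at hy
      rcases hy with rfl | ⟨z, rfl⟩
      · simp [hx]
      · simp [hmem _ z.2])
  rw [Finset.card_insert_of_notMem (by simpa using hxF), Finset.card_map, Finset.card_univ, hdeg,
    ← Nat.card_eq_fintype_card] at hle
  change Nat.card F + 1 ≤ q at hle
  omega

theorem exists_isConj (hK : Nat.card K = q ^ 2) (hF : Nat.card F = q) :
    ∃ σ : K →ₐ[F] K, IsConj σ ∧ ∀ x, σ x = x ^ q := by
  have := Fintype.ofFinite F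
  have hσ : ∀ x, FiniteField.frobeniusAlgHom F K x = x ^ q := fun x => by
    rw [← hF, Nat.card_eq_fintype_card]
    rfl
  refine ⟨FiniteField.frobeniusAlgHom F K, ⟨fun x => ?_, fun x hx => ?_⟩, hσ⟩
  · rw [hσ, hσ, ← pow_mul, ← sq, ← hK, Nat.card_eq_fintype_card, FiniteField.pow_card]
  · exact mem_subfield_of_pow_card_eq hF (by rw [← hσ, hx])

theorem two_ne_zero_of_odd_card (hK : Nat.card K = q ^ 2) (hq : Odd q) : (2 : K) ≠ 0 := by
  have h : ringChar K ≠ 2 := fun h => by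
    have h0 := FiniteField.even_card_of_char_two h
    rw [← Nat.card_eq_fintype_card, hK, ← Nat.even_iff] at h0
    exact Nat.not_even_iff_odd.2 hq.pow h0
  exact Ring.two_ne_zero h

/-- An odd square is 1 modulo 4, so -1 is a square in K. -/
theorem exists_sq_eq_neg_one (hK : Nat.card K = q ^ 2) (hq : Odd q) : ∃ i : K, i ^ 2 = -1 := by
  have : IsSquare (-1 : K) := by
    rw [FiniteField.isSquare_neg_one_iff, ← Nat.card_eq_fintype_card, hK]
    obtain ⟨k, rfl⟩ := hq
    have : (2 * k + 1) ^ 2 = 4 * (k ^ 2 + k) + 1 := by ring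
    omega
  obtain ⟨i, hi⟩ := this
  exact ⟨i, by rw [hi, sq]⟩

end Frobenius

/-! ### The affine cone over the hypersurface -/

section Cone

variable {K : Type*} [Field K]

theorem sum_Ioo_zero_last {M : Type*} [AddCommMonoid M] {m : ℕ} (g : Fin (m + 2) → M) :
    ∑ i ∈ Finset.Ioo 0 (Fin.last (m + 1)), g i = ∑ j : Fin m, g j.castSucc.succ := by
  symm
  refine Finset.sum_bij (fun j _ => j.castSucc.succ) (fun j _ => ?_) (fun j _ j' _ h => ?_)
    (fun i hi => ?_) fun _ _ => rfl
  · rw [Finset.mem_Ioo]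
    exact ⟨Fin.succ_pos _, by rw [← Fin.succ_last, Fin.succ_lt_succ_iff]; exact j.castSucc_lt_last⟩
  · simpa using h
  · rw [Finset.mem_Ioo, Fin.lt_def, Fin.lt_def] at hi
    simp only [Fin.val_zero, Fin.val_last] at hi
    exact ⟨⟨i - 1, by omega⟩, Finset.mem_univ _, Fin.ext (by simp; omega)⟩

/-- The vector with first coordinate `s`, last coordinate `w.2`, and `w.1` in between. -/
def coneVec {m : ℕ} (w : (Fin m → K) × K) (s : K) : Fin (m + 2) → K :=
  Fin.cons s (Fin.snoc w.1 w.2 : Fin (m + 1) → K)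

omit [Field K] in
@[simp] theorem coneVec_zero {m : ℕ} (w : (Fin m → K) × K) (s : K) : coneVec w s 0 = s := rfl

omit [Field K] in
@[simp] theorem coneVec_last {m : ℕ} (w : (Fin m → K) × K) (s : K) :
    coneVec w s (Fin.last (m + 1)) = w.2 := by
  rw [← Fin.succ_last, coneVec, Fin.cons_succ, Fin.snoc_last]

omit [Field K] in
@[simp] theorem coneVec_mid {m : ℕ} (w : (Fin m → K) × K) (s : K) (j : Fin m) :
    coneVec w s j.castSucc.succ = w.1 j := by
  rw [coneVec, Fin.cons_succ, Fin.snoc_castSucc]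

theorem sum_coord {M : Type*} [AddCommMonoid M] {m : ℕ} (g : Fin (m + 2) → M) :
    ∑ i, g i = g 0 + (∑ j : Fin m, g j.castSucc.succ + g (Fin.last (m + 1))) := by
  rw [Fin.sum_univ_succ, Fin.sum_univ_castSucc, Fin.succ_last]

/-- Coordinates of vectors, with the first one singled out. -/
def coneVecEquiv (K : Type*) [Field K] (m : ℕ) : ((Fin m → K) × K) × K ≃ (Fin (m + 2) → K) where
  toFun p := coneVec p.1 p.2
  invFun v := ((fun j => v j.castSucc.succ, v (Fin.last (m + 1))), v 0)
  left_inv p := by simp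
  right_inv v := by
    ext i
    refine Fin.cases ?_ (fun i => Fin.lastCases ?_ (fun j => ?_) i) i
    · simp
    · rw [Fin.succ_last]; simp
    · simp

theorem smul_coneVec {m : ℕ} (t : K) (w : (Fin m → K) × K) (s : K) :
    t • coneVec w s = coneVec (t • w) (t * s) := by
  apply (coneVecEquiv K m).symm.injective
  rw [show coneVec (t • w) (t * s) = coneVecEquiv K m (t • w, t * s) from rfl,
    Equiv.symm_apply_apply]
  ext <;> simp [coneVecEquiv]

variable [Fintype K]

/-- Scaling carries the slice X_0 = 1 onto each slice X_0 = s with s ≠ 0. -/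
theorem numSol_cone {m : ℕ} {p : (Fin (m + 2) → K) → Prop}
    (hp : ∀ (t : K) v, t ≠ 0 → (p (t • v) ↔ p v)) :
    numSol p = (Nat.card K - 1) * numSol (fun w => p (coneVec w 1))
      + numSol (fun w => p (coneVec w 0)) := by
  classical
  have h : ∀ s : K, numSol (fun w => p (coneVec w s)) = numSol (fun w => p (coneVec w 1))
      + if s = 0 then numSol (fun w => p (coneVec w 0)) - numSol (fun w => p (coneVec w 1))
        else 0 := fun s => by
    by_cases hs : s = 0
    · simp [hs]
    · rw [if_neg hs, add_zero, ← numSol_equiv (MulAction.toPerm (Units.mk0 s hs))]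
      refine numSol_congr fun w => ?_
      rw [← hp s (coneVec w 1) hs, smul_coneVec, mul_one]
      rfl
  rw [← numSol_equiv (coneVecEquiv K m), numSol_prod]
  change ∑ s, numSol (fun w => p (coneVec w s)) = _
  rw [Finset.sum_congr rfl fun s _ => h s, Finset.sum_add_distrib]
  simp only [Finset.sum_const, Finset.card_univ, nsmul_eq_mul, Finset.sum_ite_eq',
    Finset.mem_univ, if_true, Nat.card_eq_fintype_card]
  ring

/-- Each point accounts for exactly the |K| - 1 nonzero multiples of its representative, and the
zero vector is excluded by `h0`. -/
theorem numSol_projectivization {n : ℕ} {p : (Fin n → K) → Prop}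
    (hp : ∀ (t : K) v, t ≠ 0 → (p (t • v) ↔ p v)) (h0 : ¬ p 0) :
    numSol p = (Nat.card K - 1) * numSol (fun P : ℙ K (Fin n → K) => p P.rep) := by
  have hK : (Nat.card Kˣ : ℤ) = Nat.card K - 1 := by
    rw [Nat.card_units, Nat.cast_sub Nat.card_pos, Nat.cast_one]
  rw [← hK]
  unfold numSol
  rw [← Nat.cast_mul, ← Nat.card_prod, Nat.cast_inj]
  refine (Nat.card_congr (Equiv.ofBijective
    (fun s => ⟨(s.1 : K) • s.2.1.rep, (hp _ _ s.1.ne_zero).2 s.2.2⟩) ⟨?_, ?_⟩)).symm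
  · rintro ⟨u, P, hP⟩ ⟨u', P', hP'⟩ h
    simp only [Subtype.mk.injEq] at h
    have hPP : P = P' := by
      rw [← P.mk_rep, ← P'.mk_rep, Projectivization.mk_eq_mk_iff']
      refine ⟨(u : K)⁻¹ * u', ?_⟩
      rw [mul_smul, ← h, smul_smul, inv_mul_cancel₀ u.ne_zero, one_smul]
    subst hPP
    have huu : u = u' := Units.ext (smul_left_injective K P.rep_nonzero h)
    rw [huu]
  · rintro ⟨v, hv⟩
    have hv0 : v ≠ 0 := fun h => h0 (h ▸ hv)
    obtain ⟨a, ha⟩ := Projectivization.exists_smul_eq_mk_rep K v hv0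
    refine ⟨⟨a⁻¹, Projectivization.mk K v hv0, ?_⟩, ?_⟩
    · change p (Projectivization.mk K v hv0).rep
      rw [← ha]
      exact (hp _ _ a.ne_zero).2 hv
    · ext1
      change ((a⁻¹ : Kˣ) : K) • (Projectivization.mk K v hv0).rep = v
      rw [← ha, ← Units.smul_def, inv_smul_smul]

end Cone

/-! ### Affine points and points at infinity of the hypersurface -/

section HypersurfaceCone

variable {K : Type*} [Field K] {F : Subfield K} {σ : K →ₐ[F] K} {q m : ℕ} {α β : K}

theorem eval_smul_hypersurfacePoly (hq : 0 < q) (r : ℕ) (α β : K) {t : K} (ht : t ≠ 0)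
    {v : Fin (r + 1) → K} (hv : v ≠ 0) :
    MvPolynomial.eval (t • v) (hypersurfacePoly q r α β) = 0 ↔
      MvPolynomial.eval v (hypersurfacePoly q r α β) = 0 := by
  have htv : t • v ≠ 0 := smul_ne_zero ht hv
  rw [← mk_mem_hypersurface hq r α β _ hv, ← mk_mem_hypersurface hq r α β _ htv,
    show Projectivization.mk K (t • v) htv = Projectivization.mk K v hv from
      (Projectivization.mk_eq_mk_iff' K _ _ _ _).2 ⟨t, rfl⟩]

theorem eval_coneVec_one (hσ : IsConj σ) (hσq : ∀ x, σ x = x ^ q) (w : (Fin m → K) × K) :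
    MvPolynomial.eval (coneVec w 1) (hypersurfacePoly q (m + 1) α β) = 0 ↔
      w.2 - affineSection σ α β w.1 ∈ F := by
  have h : w.2 - affineSection σ α β w.1 ∈ F ↔
      σ (w.2 - affineSection σ α β w.1) - (w.2 - affineSection σ α β w.1) = 0 :=
    ⟨fun h => sub_eq_zero.2 (apply_coe σ ⟨_, h⟩), fun h => hσ.mem _ (sub_eq_zero.1 h)⟩
  have h2 : ∀ x : K, x ^ (2 * q) = σ x ^ 2 := fun x => by rw [hσq, ← pow_mul, mul_comm]
  have h3 : ∀ x : K, x ^ (q + 1) = x * σ x := fun x => by rw [hσq, pow_succ']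
  rw [eval_hypersurfacePoly_affine _ _ _ _ _ (coneVec_zero w 1), sum_Ioo_zero_last,
    sum_Ioo_zero_last, sum_Ioo_zero_last, h, affineSection]
  simp only [coneVec_last, coneVec_mid, h2, h3, ← hσq, map_sub, map_sum, map_mul, map_pow,
    hσ.apply_apply, Finset.sum_sub_distrib, ← Finset.mul_sum]
  have h4 : ∑ i, σ (w.1 i) * w.1 i = ∑ i, w.1 i * σ (w.1 i) :=
    Finset.sum_congr rfl fun i _ => mul_comm _ _
  rw [h4]
  constructor <;> intro h <;> linear_combination h

/-- Every term with a positive power of X_0 drops out (q > 1 is needed for X_0^{q-1}), and what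
remains is α^q times the conjugate of ∑ x_i². -/
theorem eval_coneVec_zero (hσq : ∀ x, σ x = x ^ q) (hq : 1 < q) (hα : α ≠ 0)
    (w : (Fin m → K) × K) :
    MvPolynomial.eval (coneVec w 0) (hypersurfacePoly q (m + 1) α β) = 0 ↔
      ∑ i, w.1 i ^ 2 = 0 := by
  have h2 : ∀ x : K, x ^ (2 * q) = σ (x ^ 2) := fun x => by rw [hσq, ← pow_mul]
  simp only [hypersurfacePoly, sum_Ioo_zero_last, map_sub, map_add, map_mul, map_pow, map_sum,
    MvPolynomial.eval_X, MvPolynomial.eval_C, coneVec_zero, coneVec_mid]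
  rw [zero_pow (by omega), zero_pow (by omega), zero_pow (by omega), zero_pow (by omega)]
  simp only [h2, ← map_sum, mul_zero, sub_zero, zero_add, mul_eq_zero, map_eq_zero,
    pow_ne_zero q hα, false_or]

theorem sum_mul_coneVec (a : Fin (m + 2) → K) (w : (Fin m → K) × K) (s : K) :
    ∑ i, a i * coneVec w s i
      = a 0 * s + (∑ j : Fin m, a j.castSucc.succ * w.1 j + a (Fin.last (m + 1)) * w.2) := by
  rw [sum_coord]
  simp

/-- Parametrization of the affine points of the hypersurface. -/
def affineEquiv (σ : K →ₐ[F] K) (α β : K) (m : ℕ) :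
    F × (Fin m → K) ≃ {w : (Fin m → K) × K // w.2 - affineSection σ α β w.1 ∈ F} where
  toFun p := ⟨(p.2, affineSection σ α β p.2 + p.1), by simp⟩
  invFun w := (⟨_, w.2⟩, w.1.1)
  left_inv p := by simp
  right_inv w := by simp

theorem numSol_affine (s : (Fin m → K) × K → Prop) :
    numSol (fun w : (Fin m → K) × K => w.2 - affineSection σ α β w.1 ∈ F ∧ s w)
      = numSol (fun p : F × (Fin m → K) => s (p.2, affineSection σ α β p.2 + p.1)) := by
  unfold numSol
  exact congrArg Nat.cast (Nat.card_congr (((affineEquiv σ α β m).subtypeEquiv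
    fun p => Iff.rfl).trans (Equiv.subtypeSubtypeEquivSubtypeInter
      (fun w : (Fin m → K) × K => w.2 - affineSection σ α β w.1 ∈ F) s))).symm

variable [Fintype K]

/-- The number of vectors of the cone over the hypersurface off the hyperplane `∑ a_i X_i = 0`. -/
theorem numSol_cone_off_hyperplane (hσ : IsConj σ) (hσq : ∀ x, σ x = x ^ q) (hq : 1 < q)
    (hα : α ≠ 0) (a : Fin (m + 2) → K) :
    numSol (fun v => MvPolynomial.eval v (hypersurfacePoly q (m + 1) α β) = 0 ∧
        ∑ i, a i * v i ≠ 0)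
      = (Nat.card K - 1) * numSol (fun p : F × (Fin m → K) => a 0 +
          (∑ j : Fin m, a j.castSucc.succ * p.2 j
            + a (Fin.last (m + 1)) * (affineSection σ α β p.2 + p.1)) ≠ 0)
        + numSol (fun w : (Fin m → K) × K => ∑ j, w.1 j ^ 2 = 0 ∧
          ∑ j : Fin m, a j.castSucc.succ * w.1 j + a (Fin.last (m + 1)) * w.2 ≠ 0) := by
  rw [numSol_cone]
  · simp only [eval_coneVec_one hσ hσq, eval_coneVec_zero hσq hq hα, sum_mul_coneVec, mul_one,
      mul_zero, zero_add]
    rw [numSol_affine]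
  · intro t v ht
    by_cases hv : v = 0
    · simp [hv]
    · rw [eval_smul_hypersurfacePoly (by omega) _ _ _ ht hv]
      simp only [Pi.smul_apply, smul_eq_mul, mul_left_comm _ t, ← Finset.mul_sum, ne_eq,
        mul_eq_zero, ht, false_or]

theorem numSol_cone_ne_zero (hσ : IsConj σ) (hσq : ∀ x, σ x = x ^ q) (hq : 1 < q) (hα : α ≠ 0) :
    numSol (fun v => MvPolynomial.eval v (hypersurfacePoly q (m + 1) α β) = 0 ∧ v ≠ 0)
      = (Nat.card K - 1) * (Nat.card F * (Nat.card K : ℤ) ^ m)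
        + (Nat.card K * numSol (fun x : Fin m → K => ∑ j, x j ^ 2 = 0) - 1) := by
  have h1 : ∀ w : (Fin m → K) × K, coneVec w 1 ≠ 0 := fun w h => by
    simpa using congrFun h 0
  have h0 : ∀ w : (Fin m → K) × K, coneVec w 0 = 0 ↔ w = 0 := fun w => by
    rw [← (coneVecEquiv K m).symm.injective.eq_iff,
      show coneVec w 0 = coneVecEquiv K m (w, 0) from rfl, Equiv.symm_apply_apply,
      show (coneVecEquiv K m).symm 0 = (0, 0) from rfl, Prod.mk.injEq]
    simp
  rw [numSol_cone]
  · simp only [eval_coneVec_one hσ hσq, eval_coneVec_zero hσq hq hα]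
    rw [numSol_affine]
    simp only [h1, ne_eq, not_false_eq_true, numSol_true, h0]
    have h2 := numSol_and_add_and_not (fun w : (Fin m → K) × K => ∑ j, w.1 j ^ 2 = 0)
      fun w => w = 0
    have h3 : numSol (fun w : (Fin m → K) × K => ∑ j, w.1 j ^ 2 = 0 ∧ w = 0) = 1 :=
      numSol_eq_one 0 fun w => ⟨fun h => h.2, fun h => ⟨by simp [h], h⟩⟩
    have h4 : numSol (fun w : (Fin m → K) × K => ∑ j, w.1 j ^ 2 = 0)
        = Nat.card K * numSol (fun x : Fin m → K => ∑ j, x j ^ 2 = 0) := by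
      rw [numSol_prod]
      simp
    rw [Nat.card_prod, Nat.card_fun, Nat.card_fin]
    push_cast
    linear_combination h2 - h3 + h4
  · intro t v ht
    by_cases hv : v = 0
    · simp [hv]
    · rw [eval_smul_hypersurfacePoly (by omega) _ _ _ ht hv]
      simp [ht]

theorem numSol_infinity_of_last_ne_zero (b : Fin m → K) {d : K} (hd : d ≠ 0) :
    numSol (fun w : (Fin m → K) × K => ∑ j, w.1 j ^ 2 = 0 ∧ ∑ j, b j * w.1 j + d * w.2 ≠ 0)
      = (Nat.card K - 1) * numSol (fun x : Fin m → K => ∑ j, x j ^ 2 = 0) := by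
  classical
  have h2 := numSol_and_add_and_not (fun w : (Fin m → K) × K => ∑ j, w.1 j ^ 2 = 0)
    fun w => ∑ j, b j * w.1 j + d * w.2 = 0
  have h3 : numSol (fun w : (Fin m → K) × K => ∑ j, w.1 j ^ 2 = 0 ∧
      ∑ j, b j * w.1 j + d * w.2 = 0) = numSol (fun x : Fin m → K => ∑ j, x j ^ 2 = 0) := by
    rw [← numSol_equiv (Equiv.prodComm K (Fin m → K)), numSol_prod, numSol_eq_sum]
    refine Finset.sum_congr rfl fun x _ => ?_
    simp only [Equiv.prodComm_apply, Prod.swap_prod_mk]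
    split_ifs with h
    · refine numSol_eq_one (-(∑ j, b j * x j) / d) fun y => ?_
      rw [eq_div_iff hd]
      simp only [h, true_and]
      constructor <;> intro h <;> linear_combination h
    · exact numSol_eq_zero fun y hy => h hy.1
  have h4 : numSol (fun w : (Fin m → K) × K => ∑ j, w.1 j ^ 2 = 0)
      = Nat.card K * numSol (fun x : Fin m → K => ∑ j, x j ^ 2 = 0) := by
    rw [numSol_prod]
    simp
  linear_combination h2 - h3 + h4

theorem numSol_infinity_of_last_eq_zero (b : Fin m → K) :
    numSol (fun w : (Fin m → K) × K => ∑ j, w.1 j ^ 2 = 0 ∧ ∑ j, b j * w.1 j + 0 * w.2 ≠ 0)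
      = Nat.card K * numSol (fun x : Fin m → K => ∑ j, x j ^ 2 = 0 ∧ ∑ j, b j * x j ≠ 0) := by
  rw [numSol_prod]
  simp

theorem numSol_affine_of_last_eq_zero (s : K → Prop) (g : (Fin m → K) → K)
    (h : F × (Fin m → K) → K) :
    numSol (fun p : F × (Fin m → K) => s (g p.2 + 0 * h p))
      = Nat.card F * numSol (fun x : Fin m → K => s (g x)) := by
  have := Fintype.ofFinite F
  rw [← numSol_equiv (Equiv.prodComm (Fin m → K) F), numSol_prod]
  simp

end HypersurfaceCone

/-! ### Projective codes -/

section ProjectiveCodes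

variable {K : Type*} [Field K]

theorem hammingNorm_eq_numSol [DecidableEq K] {n : ℕ} (c : Fin n → K) :
    (hammingNorm c : ℤ) = numSol fun j => c j ≠ 0 := by
  unfold numSol hammingNorm
  rw [Nat.card_eq_fintype_card, Fintype.card_subtype]

/-- The number of points of `S` off the hyperplane `∑ a_i X_i = 0`. -/
noncomputable def weightOf {r : ℕ} (S : Set (ℙ K (Fin (r + 1) → K))) (a : Fin (r + 1) → K) : ℤ :=
  numSol fun P : ℙ K (Fin (r + 1) → K) => P ∈ S ∧ ∑ i, a i * P.rep i ≠ 0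

theorem exists_isProjectiveCodeOf [Finite K] {r : ℕ} (S : Set (ℙ K (Fin (r + 1) → K))) :
    ∃ (n : ℕ) (C : Submodule K (Fin n → K)), IsProjectiveCodeOf S C := by
  refine ⟨Nat.card S, _, (Finite.equivFin S).symm,
    Matrix.of fun i j => ((Finite.equivFin S).symm j).1.rep i, fun j => ?_, rfl⟩
  exact ⟨((Finite.equivFin S).symm j).1.rep_nonzero, Projectivization.mk_rep _⟩

theorem IsProjectiveCodeOf.length {r n : ℕ} {S : Set (ℙ K (Fin (r + 1) → K))}
    {C : Submodule K (Fin n → K)} (hC : IsProjectiveCodeOf S C) :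
    (n : ℤ) = numSol fun P => P ∈ S := by
  obtain ⟨P, -⟩ := hC
  have := Nat.card_congr P
  rw [Nat.card_fin] at this
  rw [this]
  rfl

/-- Another choice of coordinate vectors only rescales the entries of a word by units, so its weight
depends on S and a alone. -/
theorem IsProjectiveCodeOf.exists_encoding [DecidableEq K] {r n : ℕ}
    {S : Set (ℙ K (Fin (r + 1) → K))} {C : Submodule K (Fin n → K)}
    (hC : IsProjectiveCodeOf S C) :
    ∃ enc : (Fin (r + 1) → K) →ₗ[K] (Fin n → K), C = LinearMap.range enc ∧
      ∀ a, (hammingNorm (enc a) : ℤ) = weightOf S a := by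
  obtain ⟨P, G, hG, rfl⟩ := hC
  refine ⟨G.vecMulLinear, ?_, fun a => ?_⟩
  · rw [range_vecMulLinear]
    rfl
  · rw [hammingNorm_eq_numSol]
    have h : ∀ j, (G.vecMulLinear a j ≠ 0 ↔ ∑ i, a i * (P j).1.rep i ≠ 0) := fun j => by
      obtain ⟨h0, hj⟩ := hG j
      obtain ⟨u, hu⟩ := Projectivization.exists_smul_eq_mk_rep K _ h0
      rw [hj] at hu
      rw [← hu]
      have : ∑ i, a i * (u • G.col j) i = u * ∑ i, a i * G i j := by
        rw [Finset.mul_sum]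
        refine Finset.sum_congr rfl fun i _ => ?_
        simp only [Units.smul_def, Pi.smul_apply, smul_eq_mul, Matrix.col_apply]
        ring
      rw [this, ne_eq, ne_eq, mul_eq_zero, or_iff_right u.ne_zero]
      rfl
    rw [numSol_congr h]
    refine (numSol_equiv P fun Q : S => ∑ i, a i * Q.1.rep i ≠ 0).trans ?_
    exact congrArg Nat.cast (Nat.card_congr (Equiv.subtypeSubtypeEquivSubtypeInter
      (fun Q => Q ∈ S) fun Q => ∑ i, a i * Q.rep i ≠ 0))

open Classical in
theorem numSol_mul_ne_zero [Finite K] (x y : K) (h : x = 0 → y = 0) :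
    numSol (fun t : K => x + t * y ≠ 0)
      = Nat.card K * (if x ≠ 0 then 1 else 0) - if y ≠ 0 then 1 else 0 := by
  have h1 := numSol_add_not fun t : K => x + t * y = 0
  by_cases hy : y = 0
  · by_cases hx : x = 0
    · simpa [hx, hy] using numSol_eq_zero fun _ => not_false
    · simp [hx, hy, numSol_true]
  · have hx : x ≠ 0 := mt h hy
    have h2 : numSol (fun t : K => x + t * y = 0) = 1 := numSol_eq_one (-x / y) fun t => by
      rw [eq_div_iff hy]
      constructor <;> intro h <;> linear_combination h
    rw [if_pos hx, if_pos hy]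
    linear_combination h1 - h2

/-- The Ashikhmin–Barg criterion. -/
theorem isMinimalCode_of_weights [Finite K] [DecidableEq K] {n : ℕ} {C : Submodule K (Fin n → K)}
    {wmin wmax : ℤ} (hmin : ∀ c ∈ C, c ≠ 0 → wmin ≤ hammingNorm c)
    (hmax : ∀ c ∈ C, c ≠ 0 → (hammingNorm c : ℤ) ≤ wmax)
    (h : (Nat.card K - 1) * wmax < Nat.card K * wmin) : IsMinimalCode C := by
  have := Fintype.ofFinite K
  intro c hc c' hc' hsupp
  by_contra! hne
  have hc'0 : c' ≠ 0 := fun h => hne 0 (by simp [h])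
  have hc0 : c ≠ 0 := by
    rintro rfl
    rw [Function.support_zero, Set.subset_empty_iff, Function.support_eq_empty_iff] at hsupp
    exact hc'0 hsupp
  have hcomb : ∀ t : K, c + t • c' ≠ 0 := fun t ht => by
    by_cases ht0 : t = 0
    · rw [ht0, zero_smul, add_zero] at ht
      exact hc0 ht
    · refine hne (-t⁻¹) ?_
      rw [eq_neg_of_add_eq_zero_left ht, smul_neg, neg_smul, neg_neg, smul_smul,
        inv_mul_cancel₀ ht0, one_smul]
  -- A coordinate where c' is nonzero also has c nonzero, and c + t c' vanishes there for exactly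
  -- one t. Removing t = 0 and bounding the other words below by `wmin` gives (|K| - 1) `wmin` ≤
  -- (|K| - 1) `wmax` - `wmin`, contrary to `h`.
  have hsum : ∑ t : K, (hammingNorm (c + t • c') : ℤ)
      = Nat.card K * hammingNorm c - hammingNorm c' := by
    simp only [hammingNorm_eq_numSol]
    rw [← numSol_prod fun p : Fin n × K => (c + p.2 • c') p.1 ≠ 0,
      ← numSol_equiv (Equiv.prodComm K (Fin n)), numSol_prod, numSol_eq_sum, numSol_eq_sum,
      Finset.mul_sum, ← Finset.sum_sub_distrib]
    refine Finset.sum_congr rfl fun j _ => ?_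
    change numSol (fun t : K => c j + t * c' j ≠ 0) = _
    rw [numSol_mul_ne_zero (c j) (c' j) fun hj => by_contra fun h => hsupp h hj]
    split_ifs <;> rfl
  rw [← Finset.add_sum_erase _ _ (Finset.mem_univ (0 : K)), zero_smul, add_zero] at hsum
  have hge : (Nat.card K - 1) * wmin
      ≤ ∑ t ∈ Finset.univ.erase (0 : K), (hammingNorm (c + t • c') : ℤ) := by
    have := Finset.card_nsmul_le_sum (Finset.univ.erase (0 : K))
      (fun t => (hammingNorm (c + t • c') : ℤ)) wmin fun t _ =>
        hmin _ (C.add_mem hc (C.smul_mem t hc')) (hcomb t)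
    rwa [Finset.card_erase_of_mem (Finset.mem_univ _), Finset.card_univ,
      ← Nat.card_eq_fintype_card, nsmul_eq_mul, Nat.cast_sub Nat.card_pos, Nat.cast_one] at this
  have h1 := hmin c' hc' hc'0
  have h2 := hmax c hc hc0
  have h3 : (1 : ℤ) ≤ Nat.card K := by exact_mod_cast Nat.card_pos
  have h4 : (Nat.card K - 1 : ℤ) * hammingNorm c ≤ (Nat.card K - 1) * wmax :=
    mul_le_mul_of_nonneg_left h2 (by linarith)
  linarith

/-- The properties of a projective code that follow from the list of its five weights. -/
theorem five_weight_code [Finite K] [DecidableEq K] {r n q : ℕ} (hK : Nat.card K = q ^ 2)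
    {S : Set (ℙ K (Fin (r + 1) → K))} {C : Submodule K (Fin n → K)}
    (hC : IsProjectiveCodeOf S C) {w₁ w₂ w₃ w₄ w₅ : ℤ}
    (hS : weightOf S '' {a | a ≠ 0} = {w₁, w₂, w₃, w₄, w₅})
    (h5 : 0 < w₅) (h54 : w₅ < w₄) (h43 : w₄ < w₃) (h32 : w₃ < w₂) (h21 : w₂ < w₁)
    (hd₁ : (q : ℤ) ∣ w₁) (hd₂ : (q : ℤ) ∣ w₂) (hd₃ : (q : ℤ) ∣ w₃) (hd₄ : (q : ℤ) ∣ w₄)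
    (hd₅ : (q : ℤ) ∣ w₅) (hw : ((q : ℤ) ^ 2 - 1) * w₁ < (q : ℤ) ^ 2 * w₅) :
    Module.finrank K C = r + 1 ∧ IsDivisibleCode q C ∧ IsMinimalCode C ∧
      (fun w : ℕ => (w : ℤ)) '' nonzeroWeights C = {w₁, w₂, w₃, w₄, w₅} ∧
      (nonzeroWeights C).ncard = 5 ∧
      (∃ wmin wmax : ℕ, IsLeast (nonzeroWeights C) wmin ∧ IsGreatest (nonzeroWeights C) wmax ∧
        (wmin : ℚ) / (wmax : ℚ) > ((q : ℚ) ^ 2 - 1) / (q : ℚ) ^ 2) := by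
  obtain ⟨enc, rfl, henc⟩ := hC.exists_encoding
  have hmem : ∀ a ≠ 0, weightOf S a ∈ ({w₁, w₂, w₃, w₄, w₅} : Set ℤ) := fun a ha =>
    hS ▸ Set.mem_image_of_mem _ ha
  -- A nonzero a in the kernel would give weight 0, but all five weights are positive.
  have hinj : Function.Injective enc := by
    rw [injective_iff_map_eq_zero]
    intro a ha
    by_contra ha0
    have h := hmem a ha0
    rw [← henc, ha, hammingNorm_zero] at h
    simp only [Set.mem_insert_iff, Set.mem_singleton_iff, Nat.cast_zero] at h
    omega
  have himage : (fun w : ℕ => (w : ℤ)) '' nonzeroWeights (LinearMap.range enc)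
      = {w₁, w₂, w₃, w₄, w₅} := by
    rw [← hS]
    ext w
    constructor
    · rintro ⟨_, ⟨_, ⟨a, rfl⟩, ha0, rfl⟩, rfl⟩
      exact ⟨a, fun h => ha0 (by rw [h, map_zero]), (henc a).symm⟩
    · rintro ⟨a, ha, rfl⟩
      exact ⟨_, ⟨_, ⟨a, rfl⟩, (map_ne_zero_iff enc hinj).2 ha, rfl⟩, henc a⟩
  have hword : ∀ c ∈ LinearMap.range enc, c ≠ 0 →
      (hammingNorm c : ℤ) ∈ ({w₁, w₂, w₃, w₄, w₅} : Set ℤ) := fun c hc hc0 => by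
    rw [← himage]
    exact ⟨_, ⟨c, hc, hc0, rfl⟩, rfl⟩
  have hweight : ∀ w ∈ nonzeroWeights (LinearMap.range enc),
      (w : ℤ) ∈ ({w₁, w₂, w₃, w₄, w₅} : Set ℤ) := fun w hw => himage ▸ ⟨w, hw, rfl⟩
  have hex : ∀ w ∈ ({w₁, w₂, w₃, w₄, w₅} : Set ℤ),
      ∃ v ∈ nonzeroWeights (LinearMap.range enc), (v : ℤ) = w := fun w hw => by
    rwa [← himage] at hw
  simp only [Set.mem_insert_iff, Set.mem_singleton_iff] at hword hweight hex
  refine ⟨?_, ?_, ?_, himage, ?_, ?_⟩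
  · rw [LinearMap.finrank_range_of_inj hinj, Module.finrank_fin_fun]
  · intro c hc
    by_cases hc0 : c = 0
    · simp [hc0]
    · rw [← Int.natCast_dvd_natCast]
      rcases hword c hc hc0 with h | h | h | h | h <;> rw [h] <;> assumption
  · refine isMinimalCode_of_weights (wmin := w₅) (wmax := w₁) (fun c hc hc0 => ?_)
      (fun c hc hc0 => ?_) (by rw [hK]; exact_mod_cast hw)
    · have := hword c hc hc0
      omega
    · have := hword c hc hc0
      omega
  · have h := Set.ncard_image_of_injective (nonzeroWeights (LinearMap.range enc))
      (Nat.cast_injective (R := ℤ))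
    rw [← h, himage, Set.ncard_insert_of_notMem, Set.ncard_insert_of_notMem,
      Set.ncard_insert_of_notMem, Set.ncard_pair (by omega)] <;>
    simp only [Set.mem_insert_iff, Set.mem_singleton_iff] <;> omega
  · obtain ⟨v, hv, hv5⟩ := hex w₅ (by simp)
    obtain ⟨u, hu, hu1⟩ := hex w₁ (by simp)
    refine ⟨v, u, ⟨hv, fun w hw => ?_⟩, ⟨hu, fun w hw => ?_⟩, ?_⟩
    · have := hweight w hw
      omega
    · have := hweight w hw
      omega
    · have hu0 : (0 : ℤ) < u := by omega
      have hq0 : q ≠ 0 := by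
        rintro rfl
        exact Nat.card_pos.ne' (hK.trans (zero_pow two_ne_zero))
      have hq : (0 : ℚ) < (q : ℚ) ^ 2 := by positivity
      rw [gt_iff_lt, div_lt_div_iff₀ hq (by exact_mod_cast hu0)]
      rw [← hv5, ← hu1, mul_comm ((q : ℤ) ^ 2)] at hw
      exact_mod_cast hw

end ProjectiveCodes

/-! ### The weights of the code of the hypersurface -/

section Weights

variable {K : Type*} [Field K] [Fintype K] {F : Subfield K} {σ : K →ₐ[F] K} {q m : ℕ} {α β : K}

theorem card_sub_one_mul_weightOf (hq : 0 < q) (r : ℕ) (α β : K) (a : Fin (r + 1) → K) :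
    (Nat.card K - 1) * weightOf (hypersurface q r α β) a
      = numSol (fun v => MvPolynomial.eval v (hypersurfacePoly q r α β) = 0 ∧
        ∑ i, a i * v i ≠ 0) := by
  rw [numSol_projectivization]
  · rfl
  · intro t v ht
    by_cases hv : v = 0
    · simp [hv]
    · rw [eval_smul_hypersurfacePoly hq _ _ _ ht hv]
      simp only [Pi.smul_apply, smul_eq_mul, mul_left_comm _ t, ← Finset.mul_sum, ne_eq,
        mul_eq_zero, ht, false_or]
  · simp

theorem card_sub_one_mul_numSol_hypersurface (hq : 0 < q) (r : ℕ) (α β : K) :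
    (Nat.card K - 1 : ℤ) * numSol (fun P => P ∈ hypersurface q r α β)
      = numSol (fun v => MvPolynomial.eval v (hypersurfacePoly q r α β) = 0 ∧ v ≠ 0) := by
  rw [numSol_projectivization]
  · congr 1
    exact numSol_congr fun P => ⟨fun h => ⟨h, P.rep_nonzero⟩, fun h => h.1⟩
  · intro t v ht
    by_cases hv : v = 0
    · simp [hv]
    · rw [eval_smul_hypersurfacePoly hq _ _ _ ht hv]
      simp [ht]
  · simp

theorem card_sub_one_ne_zero : (Nat.card K - 1 : ℤ) ≠ 0 := by
  have h : 1 < Nat.card K := Finite.one_lt_card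
  omega

theorem weightOf_of_tail_eq_zero (hσ : IsConj σ) (hσq : ∀ x, σ x = x ^ q) (hq : 1 < q)
    (hα : α ≠ 0) {a : Fin (m + 2) → K} (h0 : a 0 ≠ 0) (hc : ∀ j : Fin m, a j.castSucc.succ = 0)
    (hl : a (Fin.last (m + 1)) = 0) :
    weightOf (hypersurface q (m + 1) α β) a = Nat.card F * (Nat.card K : ℤ) ^ m := by
  apply mul_left_cancel₀ (card_sub_one_ne_zero (K := K))
  rw [card_sub_one_mul_weightOf (by omega), numSol_cone_off_hyperplane hσ hσq hq hα]
  simp only [hc, hl, zero_mul, Finset.sum_const_zero, add_zero, ne_eq, h0, not_false_eq_true,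
    numSol_true, not_true_eq_false, and_false]
  rw [numSol_eq_zero fun _ => not_false, Nat.card_prod, Nat.card_fun, Nat.card_fin]
  push_cast
  ring

/-- The quadric contribution is kept as a parameter z, so that the isotropic and anisotropic counts,
in either parity, can be inserted alike. -/
theorem weightOf_of_last_eq_zero (hσ : IsConj σ) (hσq : ∀ x, σ x = x ^ q) (hq : 1 < q)
    (hα : α ≠ 0) {a : Fin (m + 2) → K} (hc : (fun j : Fin m => a j.castSucc.succ) ≠ 0)
    (hl : a (Fin.last (m + 1)) = 0) {z : ℤ}
    (hz : (Nat.card K : ℤ) ^ 2 * numSol (fun x : Fin m → K => ∑ j, x j ^ 2 = 0 ∧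
      ∑ j, a j.castSucc.succ * x j ≠ 0) = (Nat.card K - 1) * z) :
    Nat.card K * weightOf (hypersurface q (m + 1) α β) a
      = Nat.card F * (Nat.card K : ℤ) ^ m * (Nat.card K - 1) + z := by
  apply mul_left_cancel₀ (card_sub_one_ne_zero (K := K))
  have h1 := card_sub_one_mul_weightOf (by omega : 0 < q) (m + 1) α β a
  rw [numSol_cone_off_hyperplane hσ hσq hq hα, hl, numSol_infinity_of_last_eq_zero] at h1
  have h2 := numSol_affine_of_last_eq_zero (F := F) (fun x => a 0 + x ≠ 0)
    (fun x : Fin m → K => ∑ j : Fin m, a j.castSucc.succ * x j)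
    fun p => affineSection σ α β p.2 + p.1
  have h3 := numSol_add_not fun x : Fin m → K => a 0 + ∑ j : Fin m, a j.castSucc.succ * x j = 0
  have h4 := card_mul_numSol_dot hc (-a 0)
  simp only [← neg_eq_iff_add_eq_zero, eq_comm (a := -a 0)] at h3
  have h5 : ∀ x : Fin m → K, (a 0 + ∑ j : Fin m, a j.castSucc.succ * x j ≠ 0) ↔
      ¬ (∑ j : Fin m, a j.castSucc.succ * x j = -a 0) := fun x => not_congr
        ⟨fun h => by linear_combination h, fun h => by linear_combination h⟩
  rw [numSol_congr h5] at h2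
  rw [Nat.card_fun, Nat.card_fin] at h3
  push_cast at h3
  rw [h2] at h1
  linear_combination (Nat.card K : ℤ) * h1 + hz +
    (Nat.card K - 1 : ℤ) * Nat.card K * Nat.card F * h3
    - (Nat.card K - 1 : ℤ) * Nat.card F * h4

/-- After division by the last coefficient, the hyperplane removes the solutions of ∑ φ(x_i) = k
from the affine points. At infinity it determines x_r, leaving one point of the hypersurface off it
for each zero of ∑ x_j². -/
theorem weightOf_of_last_ne_zero (hσ : IsConj σ) (hσq : ∀ x, σ x = x ^ q) (hq : 1 < q)
    (hα : α ≠ 0) (hβ : β ∉ F) (hμ : 4 * (α / (σ β - β) * σ (α / (σ β - β))) ≠ 1)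
    {a : Fin (m + 2) → K} (hl : a (Fin.last (m + 1)) ≠ 0) :
    ∃ k : F, ((∀ j : Fin m, a j.castSucc.succ = 0) → (k = 0 ↔ a 0 / a (Fin.last (m + 1)) ∈ F)) ∧
      weightOf (hypersurface q (m + 1) α β) a = Nat.card F * (Nat.card K : ℤ) ^ m
        - numSol (fun x : Fin m → K => ∑ i, conjForm hσ (α / (σ β - β)) (x i) = k)
        + numSol (fun x : Fin m → K => ∑ j, x j ^ 2 = 0) := by
  obtain ⟨k, hk, hk'⟩ := numSol_affine_hyperplane hσ hβ hμ (a 0 / a (Fin.last (m + 1)))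
    fun j : Fin m => a j.castSucc.succ / a (Fin.last (m + 1))
  refine ⟨k, fun h => hk (by ext j; simp [h]), ?_⟩
  apply mul_left_cancel₀ (card_sub_one_ne_zero (K := K))
  rw [← hk', card_sub_one_mul_weightOf (by omega), numSol_cone_off_hyperplane hσ hσq hq hα,
    numSol_infinity_of_last_ne_zero _ hl]
  have h1 := numSol_add_not fun p : F × (Fin m → K) => a 0 / a (Fin.last (m + 1))
    + ∑ j : Fin m, a j.castSucc.succ / a (Fin.last (m + 1)) * p.2 j
    + (affineSection σ α β p.2 + p.1) = 0
  have h2 : ∀ p : F × (Fin m → K), (a 0 + (∑ j : Fin m, a j.castSucc.succ * p.2 j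
      + a (Fin.last (m + 1)) * (affineSection σ α β p.2 + p.1)) ≠ 0) ↔
      ¬ (a 0 / a (Fin.last (m + 1))
        + ∑ j : Fin m, a j.castSucc.succ / a (Fin.last (m + 1)) * p.2 j
        + (affineSection σ α β p.2 + p.1) = 0) := fun p => by
    have : a 0 + (∑ j : Fin m, a j.castSucc.succ * p.2 j
      + a (Fin.last (m + 1)) * (affineSection σ α β p.2 + p.1)) = a (Fin.last (m + 1)) *
        (a 0 / a (Fin.last (m + 1))
        + ∑ j : Fin m, a j.castSucc.succ / a (Fin.last (m + 1)) * p.2 j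
        + (affineSection σ α β p.2 + p.1)) := by
      have hs : ∑ j : Fin m, a j.castSucc.succ * p.2 j = a (Fin.last (m + 1)) *
          ∑ j : Fin m, a j.castSucc.succ / a (Fin.last (m + 1)) * p.2 j := by
        simp only [Finset.mul_sum, ← mul_assoc, mul_div_cancel₀ _ hl]
      rw [hs]
      linear_combination -mul_div_cancel₀ (a 0) hl
    rw [this, ne_eq, mul_eq_zero, or_iff_right hl]
  rw [numSol_congr h2]
  rw [Nat.card_prod, Nat.card_fun, Nat.card_fin] at h1
  push_cast at h1
  linear_combination (Nat.card K - 1 : ℤ) * h1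

theorem exists_sum_sq_eq (h2 : (2 : K) ≠ 0) {i : K} (hi : i ^ 2 = -1) (m : ℕ) (d : K) :
    ∃ b : Fin (m + 2) → K, b ≠ 0 ∧ ∑ j, b j ^ 2 = d := by
  obtain ⟨p, hp0, hp⟩ : ∃ p : K × K, p ≠ 0 ∧ p.1 ^ 2 + p.2 ^ 2 = d := by
    by_cases hd : d = 0
    · exact ⟨(1, i), by simp, by simp [hi, hd]⟩
    · have hb := (hasBias_binary_isotropic h2 one_ne_zero one_ne_zero (x := ((1 : K), i))
        (by simp) (by simp [hi])).ne_zero d hd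
      have hQ : 1 < Nat.card K := Finite.one_lt_card
      obtain ⟨p, hp⟩ := exists_of_numSol_ne_zero
        (p := fun p : K × K => 1 * p.1 ^ 2 + 1 * p.2 ^ 2 = d) (fun h => by
          rw [h, mul_zero, Nat.card_prod] at hb
          push_cast at hb
          have : (Nat.card K : ℤ) * (Nat.card K - 1) = 0 := by linear_combination -hb
          rcases mul_eq_zero.1 this with h | h <;> omega)
      refine ⟨p, ?_, by linear_combination hp⟩
      rintro rfl
      exact hd (by simpa using hp.symm)
  refine ⟨Fin.cons p.1 (Fin.cons p.2 0 : Fin (m + 1) → K), fun h => hp0 ?_, ?_⟩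
  · exact Prod.ext (congrFun h 0) (congrFun h 1)
  · simp [Fin.sum_univ_succ, hp]

end Weights

/-! ### The exact weight sets in each parity, the length, and the discriminant condition -/

section Weights

variable {K : Type*} [Field K] [Fintype K] {F : Subfield K} {σ : K →ₐ[F] K} {q : ℕ} {α β : K}

omit [Fintype K] in
theorem eq_zero_of_coords {m : ℕ} {a : Fin (m + 2) → K} (h0 : a 0 = 0)
    (hc : (fun j : Fin m => a j.castSucc.succ) = 0) (hl : a (Fin.last (m + 1)) = 0) : a = 0 :=
  (coneVecEquiv K m).symm.injective (Prod.ext (Prod.ext hc hl) h0)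

theorem exists_coeff_sum_sq_eq (h2 : (2 : K) ≠ 0) {i : K} (hi : i ^ 2 = -1) {m : ℕ} (hm : 2 ≤ m)
    (d : K) : ∃ a : Fin (m + 2) → K, a ≠ 0 ∧ (fun l : Fin m => a l.castSucc.succ) ≠ 0 ∧
      a (Fin.last (m + 1)) = 0 ∧ ∑ l : Fin m, a l.castSucc.succ ^ 2 = d := by
  obtain ⟨k, rfl⟩ := Nat.exists_eq_add_of_le' hm
  obtain ⟨b, hb0, hb⟩ := exists_sum_sq_eq h2 hi k d
  have hmid : (fun l : Fin (k + 2) => coneVec (b, (0 : K)) 0 l.castSucc.succ) = b :=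
    funext fun l => coneVec_mid _ _ l
  refine ⟨coneVec (b, 0) 0, fun h => hb0 ?_, by rwa [hmid], coneVec_last _ _, ?_⟩
  · rw [← hmid, h]
    rfl
  · simpa using hb

/-- The weights of the code, when the number `m = r - 1` of middle coordinates is even. -/
theorem image_weightOf_of_even (hσ : IsConj σ) (hσq : ∀ x, σ x = x ^ q) (hq : 1 < q)
    (hK : Nat.card K = q ^ 2) (hF : Nat.card F = q) (h2 : (2 : K) ≠ 0) {i : K} (hi : i ^ 2 = -1)
    (hα : α ≠ 0) (hβ : β ∉ F) (hμ : 4 * (α / (σ β - β) * σ (α / (σ β - β))) ≠ 1) (j : ℕ) :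
    weightOf (hypersurface q (2 * (j + 1) + 1) α β) '' {a | a ≠ 0} =
      {(q : ℤ) ^ (4 * j + 5),
        (q : ℤ) ^ (4 * j + 5) - (q : ℤ) ^ (4 * j + 3) + (q : ℤ) ^ (4 * j + 2)
          + (q : ℤ) ^ (2 * j + 2) + (q : ℤ) ^ (2 * j + 1) - (q : ℤ) ^ (2 * j),
        (q : ℤ) ^ (4 * j + 5) - (q : ℤ) ^ (4 * j + 3) + (q : ℤ) ^ (4 * j + 2)
          + (q : ℤ) ^ (2 * j + 2),
        (q : ℤ) ^ (4 * j + 5) - (q : ℤ) ^ (4 * j + 3) + (q : ℤ) ^ (4 * j + 2)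
          + (q : ℤ) ^ (2 * j + 1) - (q : ℤ) ^ (2 * j),
        (q : ℤ) ^ (4 * j + 5) - (q : ℤ) ^ (4 * j + 3) + (q : ℤ) ^ (4 * j + 2)} := by
  have hγ : σ β - β ≠ 0 := fun h => hβ (hσ.mem _ (sub_eq_zero.1 h))
  have hKz : (Nat.card K : ℤ) = (q : ℤ) ^ 2 := by rw [hK]; push_cast; rfl
  have hFz : (Nat.card F : ℤ) = q := by rw [hF]
  have hq0 : (q : ℤ) ≠ 0 := by omega
  obtain ⟨e, he, -, hbias⟩ := exists_hasBias_conjForm hσ h2 (by rw [hK, hF])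
    (div_ne_zero hα hγ) hμ
  have hN := numSol_sum_sq_even h2 hi (j + 1)
  have hb := hbias.sum_fin (2 * (j + 1))
  -- With m even, e^m = 1: the type of φ does not matter.
  rw [mul_pow, pow_mul e, he, one_pow, one_mul, hFz] at hb
  rw [hKz] at hN
  have hA : ∀ a : Fin (2 * (j + 1) + 2) → K, a 0 ≠ 0 →
      (∀ l : Fin (2 * (j + 1)), a l.castSucc.succ = 0) → a (Fin.last (2 * (j + 1) + 1)) = 0 →
      weightOf (hypersurface q (2 * (j + 1) + 1) α β) a = (q : ℤ) ^ (4 * j + 5) := by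
    intro a h0 hc hl
    rw [weightOf_of_tail_eq_zero hσ hσq hq hα h0 hc hl, hKz, hFz]
    ring
  have hB : ∀ a : Fin (2 * (j + 1) + 2) → K,
      (fun l : Fin (2 * (j + 1)) => a l.castSucc.succ) ≠ 0 → a (Fin.last (2 * (j + 1) + 1)) = 0 →
      (∑ l : Fin (2 * (j + 1)), a l.castSucc.succ ^ 2 = 0 →
        weightOf (hypersurface q (2 * (j + 1) + 1) α β) a =
          (q : ℤ) ^ (4 * j + 5) - (q : ℤ) ^ (4 * j + 3) + (q : ℤ) ^ (4 * j + 2)) ∧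
      (∑ l : Fin (2 * (j + 1)), a l.castSucc.succ ^ 2 ≠ 0 →
        weightOf (hypersurface q (2 * (j + 1) + 1) α β) a =
          (q : ℤ) ^ (4 * j + 5) - (q : ℤ) ^ (4 * j + 3) + (q : ℤ) ^ (4 * j + 2)
            + (q : ℤ) ^ (2 * j + 2)) := by
    intro a hc hl
    constructor <;> intro hs <;> apply mul_left_cancel₀ (pow_ne_zero 2 hq0)
    · have := weightOf_of_last_eq_zero (β := β) hσ hσq hq hα hc hl
        (numSol_isotropic_section h2 hc hs)
      rw [hKz, hFz] at this
      rw [this]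
      ring
    · have := weightOf_of_last_eq_zero (β := β) hσ hσq hq hα hc hl
        (numSol_anisotropic_section_even h2 hi hs)
      rw [hKz, hFz] at this
      rw [this]
      ring
  have hC : ∀ a : Fin (2 * (j + 1) + 2) → K, a (Fin.last (2 * (j + 1) + 1)) ≠ 0 → ∃ k : F,
      ((∀ l : Fin (2 * (j + 1)), a l.castSucc.succ = 0) →
        (k = 0 ↔ a 0 / a (Fin.last (2 * (j + 1) + 1)) ∈ F)) ∧
      (k = 0 → weightOf (hypersurface q (2 * (j + 1) + 1) α β) a =
        (q : ℤ) ^ (4 * j + 5) - (q : ℤ) ^ (4 * j + 3) + (q : ℤ) ^ (4 * j + 2)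
          + (q : ℤ) ^ (2 * j + 1) - (q : ℤ) ^ (2 * j)) ∧
      (k ≠ 0 → weightOf (hypersurface q (2 * (j + 1) + 1) α β) a =
        (q : ℤ) ^ (4 * j + 5) - (q : ℤ) ^ (4 * j + 3) + (q : ℤ) ^ (4 * j + 2)
          + (q : ℤ) ^ (2 * j + 2) + (q : ℤ) ^ (2 * j + 1) - (q : ℤ) ^ (2 * j)) := by
    intro a hl
    obtain ⟨k, hk, hw⟩ := weightOf_of_last_ne_zero hσ hσq hq hα hβ hμ hl
    refine ⟨k, hk, ?_, ?_⟩ <;> intro hk0 <;> apply mul_left_cancel₀ (pow_ne_zero 2 hq0) <;>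
      rw [hw, hKz, hFz]
    · have h := hb.zero
      rw [Nat.card_fun, Nat.card_fin, Nat.cast_pow, hKz, hFz] at h
      rw [hk0]
      linear_combination hN - (q : ℤ) * h
    · have h := hb.ne_zero k hk0
      rw [Nat.card_fun, Nat.card_fin, Nat.cast_pow, hKz, hFz] at h
      linear_combination hN - (q : ℤ) * h
  ext w
  simp only [Set.mem_image, Set.mem_ofPred_eq, Set.mem_insert_iff, Set.mem_singleton_iff]
  constructor
  · rintro ⟨a, ha, rfl⟩
    by_cases hl : a (Fin.last (2 * (j + 1) + 1)) = 0
    · by_cases hc : (fun l : Fin (2 * (j + 1)) => a l.castSucc.succ) = 0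
      · exact Or.inl (hA a (fun h0 => ha (eq_zero_of_coords h0 hc hl)) (congrFun hc) hl)
      · by_cases hs : ∑ l : Fin (2 * (j + 1)), a l.castSucc.succ ^ 2 = 0
        · exact Or.inr (Or.inr (Or.inr (Or.inr ((hB a hc hl).1 hs))))
        · exact Or.inr (Or.inr (Or.inl ((hB a hc hl).2 hs)))
    · obtain ⟨k, -, h1, h2⟩ := hC a hl
      by_cases hk : k = 0
      · exact Or.inr (Or.inr (Or.inr (Or.inl (h1 hk))))
      · exact Or.inr (Or.inl (h2 hk))
  · have hlast : ∀ s : K, ∃ a : Fin (2 * (j + 1) + 2) → K, a ≠ 0 ∧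
        a (Fin.last (2 * (j + 1) + 1)) ≠ 0 ∧ (∀ l : Fin (2 * (j + 1)), a l.castSucc.succ = 0) ∧
        a 0 / a (Fin.last (2 * (j + 1) + 1)) = s := fun s =>
      ⟨coneVec (0, 1) s, fun h => by simpa using congrFun h (Fin.last (2 * (j + 1) + 1)),
        by simp, by simp, by simp⟩
    have hmid := exists_coeff_sum_sq_eq h2 hi (m := 2 * (j + 1)) (by omega)
    rintro (rfl | rfl | rfl | rfl | rfl)
    · exact ⟨coneVec 0 1, fun h => by simpa using congrFun h 0,
        hA _ (by simp) (by simp) (by simp)⟩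
    -- With vanishing middle coefficients, k = 0 exactly when the ratio of the outer ones lies in F;
    -- β is outside F, while the ratio 0 used below is inside.
    · obtain ⟨a, ha, hl, hc, hs⟩ := hlast β
      obtain ⟨k, hk, -, h⟩ := hC a hl
      exact ⟨a, ha, h fun hk0 => hβ (hs ▸ (hk hc).1 hk0)⟩
    · obtain ⟨a, ha, hc, hl, hs⟩ := hmid 1
      exact ⟨a, ha, (hB a hc hl).2 (hs ▸ one_ne_zero)⟩
    · obtain ⟨a, ha, hl, hc, hs⟩ := hlast 0
      obtain ⟨k, hk, h, -⟩ := hC a hl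
      exact ⟨a, ha, h ((hk hc).2 (hs ▸ F.zero_mem))⟩
    · obtain ⟨a, ha, hc, hl, hs⟩ := hmid 0
      exact ⟨a, ha, (hB a hc hl).1 hs⟩

/-- The weights of the code, when the number `m = r - 1` of middle coordinates is odd. -/
theorem image_weightOf_of_odd (hσ : IsConj σ) (hσq : ∀ x, σ x = x ^ q) (hq : 1 < q)
    (hK : Nat.card K = q ^ 2) (hF : Nat.card F = q) (h2 : (2 : K) ≠ 0) {i : K} (hi : i ^ 2 = -1)
    (hα : α ≠ 0) (hβ : β ∉ F) (hμ : 4 * (α / (σ β - β) * σ (α / (σ β - β))) ≠ 1)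
    (hμ' : ∃ d : F, 1 - 4 * (α / (σ β - β) * σ (α / (σ β - β))) = (d : K) ^ 2) (j : ℕ) :
    weightOf (hypersurface q (2 * (j + 1) + 1 + 1) α β) '' {a | a ≠ 0} =
      {(q : ℤ) ^ (4 * j + 7),
        (q : ℤ) ^ (4 * j + 7) - (q : ℤ) ^ (4 * j + 5) + (q : ℤ) ^ (4 * j + 4)
          + (q : ℤ) ^ (2 * j + 3) - (q : ℤ) ^ (2 * j + 2),
        (q : ℤ) ^ (4 * j + 7) - (q : ℤ) ^ (4 * j + 5) + (q : ℤ) ^ (4 * j + 4)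
          + (q : ℤ) ^ (2 * j + 2),
        (q : ℤ) ^ (4 * j + 7) - (q : ℤ) ^ (4 * j + 5) + (q : ℤ) ^ (4 * j + 4),
        (q : ℤ) ^ (4 * j + 7) - (q : ℤ) ^ (4 * j + 5) + (q : ℤ) ^ (4 * j + 4)
          - (q : ℤ) ^ (2 * j + 2)} := by
  have hγ : σ β - β ≠ 0 := fun h => hβ (hσ.mem _ (sub_eq_zero.1 h))
  have hKz : (Nat.card K : ℤ) = (q : ℤ) ^ 2 := by rw [hK]; push_cast; rfl
  have hFz : (Nat.card F : ℤ) = q := by rw [hF]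
  have hq0 : (q : ℤ) ≠ 0 := by omega
  obtain ⟨e, -, he, hbias⟩ := exists_hasBias_conjForm hσ h2 (by rw [hK, hF])
    (div_ne_zero hα hγ) hμ
  have hN := numSol_sum_sq_odd h2 hi (j + 1)
  have hb := hbias.sum_fin (2 * (j + 1) + 1)
  -- With m odd the sign survives, and anisotropy makes the bias -q^m.
  rw [he hμ', mul_pow, Odd.neg_one_pow ⟨j + 1, rfl⟩, hFz] at hb
  rw [hKz] at hN
  have hA : ∀ a : Fin (2 * (j + 1) + 1 + 2) → K, a 0 ≠ 0 →
      (∀ l : Fin (2 * (j + 1) + 1), a l.castSucc.succ = 0) →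
      a (Fin.last (2 * (j + 1) + 1 + 1)) = 0 →
      weightOf (hypersurface q (2 * (j + 1) + 1 + 1) α β) a = (q : ℤ) ^ (4 * j + 7) := by
    intro a h0 hc hl
    rw [weightOf_of_tail_eq_zero hσ hσq hq hα h0 hc hl, hKz, hFz]
    ring
  have hB0 : ∀ a : Fin (2 * (j + 1) + 1 + 2) → K,
      (fun l : Fin (2 * (j + 1) + 1) => a l.castSucc.succ) ≠ 0 →
      a (Fin.last (2 * (j + 1) + 1 + 1)) = 0 →
      ∑ l : Fin (2 * (j + 1) + 1), a l.castSucc.succ ^ 2 = 0 →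
        weightOf (hypersurface q (2 * (j + 1) + 1 + 1) α β) a =
          (q : ℤ) ^ (4 * j + 7) - (q : ℤ) ^ (4 * j + 5) + (q : ℤ) ^ (4 * j + 4) := by
    intro a hc hl hs
    apply mul_left_cancel₀ (pow_ne_zero 2 hq0)
    have := weightOf_of_last_eq_zero (β := β) hσ hσq hq hα hc hl
      (numSol_isotropic_section h2 hc hs)
    rw [hKz, hFz] at this
    rw [this]
    ring
  have hB : ∀ a : Fin (2 * (j + 1) + 1 + 2) → K,
      (fun l : Fin (2 * (j + 1) + 1) => a l.castSucc.succ) ≠ 0 →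
      a (Fin.last (2 * (j + 1) + 1 + 1)) = 0 → ∀ d ≠ 0,
      ∑ l : Fin (2 * (j + 1) + 1), a l.castSucc.succ ^ 2 = d →
      (IsSquare d → weightOf (hypersurface q (2 * (j + 1) + 1 + 1) α β) a =
          (q : ℤ) ^ (4 * j + 7) - (q : ℤ) ^ (4 * j + 5) + (q : ℤ) ^ (4 * j + 4)
            - (q : ℤ) ^ (2 * j + 2)) ∧
      (¬ IsSquare d → weightOf (hypersurface q (2 * (j + 1) + 1 + 1) α β) a =
          (q : ℤ) ^ (4 * j + 7) - (q : ℤ) ^ (4 * j + 5) + (q : ℤ) ^ (4 * j + 4)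
            + (q : ℤ) ^ (2 * j + 2)) := by
    intro a hc hl d hd hs
    obtain ⟨e, he, hz⟩ := numSol_anisotropic_section_odd h2 hi hs hd
    have := weightOf_of_last_eq_zero (β := β) hσ hσq hq hα hc hl hz
    rw [hKz, hFz] at this
    constructor <;> intro hsq <;> apply mul_left_cancel₀ (pow_ne_zero 2 hq0) <;> rw [this]
    · rw [(he.resolve_right fun h => h.1 hsq).2]
      ring
    · rw [(he.resolve_left fun h => hsq h.1).2]
      ring
  have hC : ∀ a : Fin (2 * (j + 1) + 1 + 2) → K, a (Fin.last (2 * (j + 1) + 1 + 1)) ≠ 0 → ∃ k : F,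
      ((∀ l : Fin (2 * (j + 1) + 1), a l.castSucc.succ = 0) →
        (k = 0 ↔ a 0 / a (Fin.last (2 * (j + 1) + 1 + 1)) ∈ F)) ∧
      (k = 0 → weightOf (hypersurface q (2 * (j + 1) + 1 + 1) α β) a =
        (q : ℤ) ^ (4 * j + 7) - (q : ℤ) ^ (4 * j + 5) + (q : ℤ) ^ (4 * j + 4)
          + (q : ℤ) ^ (2 * j + 3) - (q : ℤ) ^ (2 * j + 2)) ∧
      (k ≠ 0 → weightOf (hypersurface q (2 * (j + 1) + 1 + 1) α β) a =
        (q : ℤ) ^ (4 * j + 7) - (q : ℤ) ^ (4 * j + 5) + (q : ℤ) ^ (4 * j + 4)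
          - (q : ℤ) ^ (2 * j + 2)) := by
    intro a hl
    obtain ⟨k, hk, hw⟩ := weightOf_of_last_ne_zero hσ hσq hq hα hβ hμ hl
    refine ⟨k, hk, ?_, ?_⟩ <;> intro hk0 <;> apply mul_left_cancel₀ (pow_ne_zero 2 hq0) <;>
      rw [hw, hKz, hFz]
    · have h := hb.zero
      rw [Nat.card_fun, Nat.card_fin, Nat.cast_pow, hKz, hFz] at h
      rw [hk0]
      linear_combination (q : ℤ) ^ 2 * hN - (q : ℤ) * h
    · have h := hb.ne_zero k hk0
      rw [Nat.card_fun, Nat.card_fin, Nat.cast_pow, hKz, hFz] at h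
      linear_combination (q : ℤ) ^ 2 * hN - (q : ℤ) * h
  ext w
  simp only [Set.mem_image, Set.mem_ofPred_eq, Set.mem_insert_iff, Set.mem_singleton_iff]
  constructor
  · rintro ⟨a, ha, rfl⟩
    by_cases hl : a (Fin.last (2 * (j + 1) + 1 + 1)) = 0
    · by_cases hc : (fun l : Fin (2 * (j + 1) + 1) => a l.castSucc.succ) = 0
      · exact Or.inl (hA a (fun h0 => ha (eq_zero_of_coords h0 hc hl)) (congrFun hc) hl)
      · by_cases hs : ∑ l : Fin (2 * (j + 1) + 1), a l.castSucc.succ ^ 2 = 0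
        · exact Or.inr (Or.inr (Or.inr (Or.inl (hB0 a hc hl hs))))
        · by_cases hsq : IsSquare (∑ l : Fin (2 * (j + 1) + 1), a l.castSucc.succ ^ 2)
          · exact Or.inr (Or.inr (Or.inr (Or.inr ((hB a hc hl _ hs rfl).1 hsq))))
          · exact Or.inr (Or.inr (Or.inl ((hB a hc hl _ hs rfl).2 hsq)))
    · obtain ⟨k, -, h1, h2⟩ := hC a hl
      by_cases hk : k = 0
      · exact Or.inr (Or.inl (h1 hk))
      -- This weight coincides with that of an anisotropic section of square class; the coincidence
      -- keeps the number of weights at five.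
      · exact Or.inr (Or.inr (Or.inr (Or.inr (h2 hk))))
  · have hmid := exists_coeff_sum_sq_eq h2 hi (m := 2 * (j + 1) + 1) (by omega)
    rintro (rfl | rfl | rfl | rfl | rfl)
    · exact ⟨coneVec 0 1, fun h => by simpa using congrFun h 0,
        hA _ (by simp) (by simp) (by simp)⟩
    · obtain ⟨k, hk, h, -⟩ := hC (coneVec (0, 1) 0) (by simp)
      exact ⟨coneVec (0, 1) 0,
        fun h => by simpa using congrFun h (Fin.last (2 * (j + 1) + 1 + 1)),
        h ((hk (by simp)).2 (by simp))⟩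
    · have hchar : ringChar K ≠ 2 := fun h => h2 (by
        have := CharP.cast_eq_zero K (ringChar K)
        rw [h] at this
        exact_mod_cast this)
      obtain ⟨d, hd⟩ := FiniteField.exists_nonsquare hchar
      obtain ⟨a, ha, hc, hl, hs⟩ := hmid d
      exact ⟨a, ha, (hB a hc hl d (fun h => hd (h ▸ IsSquare.zero)) hs).2 hd⟩
    · obtain ⟨a, ha, hc, hl, hs⟩ := hmid 0
      exact ⟨a, ha, hB0 a hc hl hs⟩
    · obtain ⟨a, ha, hc, hl, hs⟩ := hmid 1
      exact ⟨a, ha, (hB a hc hl 1 one_ne_zero hs).1 IsSquare.one⟩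

theorem IsProjectiveCodeOf.length_hypersurface (hσ : IsConj σ) (hσq : ∀ x, σ x = x ^ q)
    (hq : 1 < q) (hK : Nat.card K = q ^ 2) (hF : Nat.card F = q) (hα : α ≠ 0) {m n : ℕ}
    {C : Submodule K (Fin n → K)} (hC : IsProjectiveCodeOf (hypersurface q (m + 1) α β) C) :
    ((q : ℤ) ^ 2 - 1) * n = ((q : ℤ) ^ 2 - 1) * (q : ℤ) ^ (2 * m + 1)
      + ((q : ℤ) ^ 2 * numSol (fun x : Fin m → K => ∑ j, x j ^ 2 = 0) - 1) := by
  have hKz : (Nat.card K : ℤ) = (q : ℤ) ^ 2 := by rw [hK]; push_cast; rfl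
  have hFz : (Nat.card F : ℤ) = q := by rw [hF]
  have h := card_sub_one_mul_numSol_hypersurface (by omega : 0 < q) (m + 1) α β
  rw [numSol_cone_ne_zero hσ hσq hq hα, ← hC.length, hKz, hFz] at h
  rw [h]
  ring

omit [Fintype K] in
/-- The nondegeneracy of the form `x σ(x) + μ x² + σ(μ x²)` with `μ = α / (σ(β) - β)`. -/
theorem four_mul_conj_ne_one (hσ : IsConj σ) (hβ : β ∉ F)
    (h : 4 * (α * σ α) + (σ β - β) ^ 2 ≠ 0) :
    4 * (α / (σ β - β) * σ (α / (σ β - β))) ≠ 1 := by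
  have hγ : σ β - β ≠ 0 := fun h => hβ (hσ.mem _ (sub_eq_zero.1 h))
  have hσγ : σ (σ β - β) = -(σ β - β) := by rw [map_sub, hσ.apply_apply]; ring
  rw [map_div₀, hσγ]
  intro h1
  field_simp at h1
  exact h (by linear_combination -h1)

/-- The form `x σ(x) + μ x² + σ(μ x²)` is anisotropic when `4 α σ(α) + (σ(β) - β)²` is not a
square. -/
theorem exists_sq_eq_of_not_isSquare (hσ : IsConj σ) (h2 : (2 : K) ≠ 0) (hβ : β ∉ F) {d : F}
    (hd : (d : K) = 4 * (α * σ α) + (σ β - β) ^ 2) (hsq : ¬ IsSquare d) :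
    ∃ e : F, 1 - 4 * (α / (σ β - β) * σ (α / (σ β - β))) = (e : K) ^ 2 := by
  classical
  have := Fintype.ofFinite F
  have hγ : σ β - β ≠ 0 := fun h => hβ (hσ.mem _ (sub_eq_zero.1 h))
  have hσγ : σ (σ β - β) = -(σ β - β) := by rw [map_sub, hσ.apply_apply]; ring
  have hg : (σ β - β) ^ 2 ∈ F := hσ.mem _ (by rw [map_pow, hσγ, neg_sq])
  -- A square root of γ² in F would be ±γ, hence fixed by σ, whereas σ(γ) = -γ ≠ γ.
  have hgsq : ¬ IsSquare (⟨_, hg⟩ : F) := by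
    rintro ⟨t, ht⟩
    have ht' : (σ β - β) ^ 2 = (t : K) ^ 2 := by
      rw [sq (t : K)]
      exact congrArg Subtype.val ht
    have hmem : σ β - β ∈ F := by
      rcases sq_eq_sq_iff_eq_or_eq_neg.1 ht' with h | h
      · exact h ▸ t.2
      · exact h ▸ F.neg_mem t.2
    have h1 : σ (σ β - β) = σ β - β := apply_coe σ ⟨_, hmem⟩
    rw [hσγ] at h1
    exact mul_ne_zero h2 hγ (by linear_combination -h1)
  -- A product of two non-squares is a square, and the discriminant 1 - 4μσ(μ) equals d/γ² =
  -- dγ²/(γ²)².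
  have hchar : quadraticChar F (d * ⟨_, hg⟩) = 1 := by
    rw [map_mul, quadraticChar_neg_one_iff_not_isSquare.2 hsq,
      quadraticChar_neg_one_iff_not_isSquare.2 hgsq]
    norm_num
  have hne : d * ⟨_, hg⟩ ≠ 0 := fun h => by simp [h] at hchar
  obtain ⟨t, ht⟩ := (quadraticChar_one_iff_isSquare hne).1 hchar
  have ht' : (d : K) * (σ β - β) ^ 2 = (t : K) * t := congrArg Subtype.val ht
  refine ⟨t / ⟨_, hg⟩, ?_⟩
  rw [Subfield.coe_div, map_div₀, hσγ]
  change _ = ((t : K) / (σ β - β) ^ 2) ^ 2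
  rw [div_pow, sq (t : K), ← ht', hd]
  field_simp
  ring

end Weights

end MinimalCodes

set_option maxHeartbeats 800000 in
/-- `K` is `GF(q^2)` and `F` is its subfield `GF(q)`. -/
theorem theorem5p1 {K : Type*} [Field K] [DecidableEq K] (q r : ℕ)
    (hq : IsPrimePow q) (hqodd : Odd q) (hr : 3 < r)
    (hK : Nat.card K = q ^ 2) (F : Subfield K) (hF : Nat.card F = q)
    (α β : K) (hα : α ≠ 0) (hβ : β ∉ F)
    (hαβ : (Odd r ∧ 4 * α ^ (q + 1) + (β ^ q - β) ^ 2 ≠ 0) ∨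
      (Even r ∧ ∃ d : F, (d : K) = 4 * α ^ (q + 1) + (β ^ q - β) ^ 2 ∧ ¬ IsSquare d)) :
    (∃ (n : ℕ) (C : Submodule K (Fin n → K)),
      MinimalCodes.IsProjectiveCodeOf (MinimalCodes.hypersurface q r α β) C) ∧
    ∀ (n : ℕ) (C : Submodule K (Fin n → K)),
      MinimalCodes.IsProjectiveCodeOf (MinimalCodes.hypersurface q r α β) C →
      Module.finrank K C = r + 1 ∧
      MinimalCodes.IsDivisibleCode q C ∧
      MinimalCodes.IsMinimalCode C ∧
      (Odd r →
        (n : ℚ) = (q : ℚ) ^ (2 * r - 1) + (q : ℚ) ^ (r - 1)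
          + ((q : ℚ) ^ (2 * (r - 1)) - (q : ℚ) ^ 2) / ((q : ℚ) ^ 2 - 1) + 1 ∧
        (fun w : ℕ => (w : ℤ)) '' MinimalCodes.nonzeroWeights C =
          { (q : ℤ) ^ (2 * r - 1),
            (q : ℤ) ^ (2 * r - 1) - (q : ℤ) ^ (2 * r - 3) + (q : ℤ) ^ (2 * (r - 2))
              + (q : ℤ) ^ (r - 1) + (q : ℤ) ^ (r - 2) - (q : ℤ) ^ (r - 3),
            (q : ℤ) ^ (2 * r - 1) - (q : ℤ) ^ (2 * r - 3) + (q : ℤ) ^ (2 * (r - 2))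
              + (q : ℤ) ^ (r - 1),
            (q : ℤ) ^ (2 * r - 1) - (q : ℤ) ^ (2 * r - 3) + (q : ℤ) ^ (2 * (r - 2))
              + (q : ℤ) ^ (r - 2) - (q : ℤ) ^ (r - 3),
            (q : ℤ) ^ (2 * r - 1) - (q : ℤ) ^ (2 * r - 3) + (q : ℤ) ^ (2 * (r - 2)) }) ∧
      (Even r →
        (n : ℚ) = (q : ℚ) ^ (2 * r - 1)
          + ((q : ℚ) ^ (2 * (r - 1)) - (q : ℚ) ^ 2) / ((q : ℚ) ^ 2 - 1) + 1 ∧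
        (fun w : ℕ => (w : ℤ)) '' MinimalCodes.nonzeroWeights C =
          { (q : ℤ) ^ (2 * r - 1),
            (q : ℤ) ^ (2 * r - 1) - (q : ℤ) ^ (2 * r - 3) + (q : ℤ) ^ (2 * (r - 2))
              + (q : ℤ) ^ (r - 1) - (q : ℤ) ^ (r - 2),
            (q : ℤ) ^ (2 * r - 1) - (q : ℤ) ^ (2 * r - 3) + (q : ℤ) ^ (2 * (r - 2))
              + (q : ℤ) ^ (r - 2),
            (q : ℤ) ^ (2 * r - 1) - (q : ℤ) ^ (2 * r - 3) + (q : ℤ) ^ (2 * (r - 2)),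
            (q : ℤ) ^ (2 * r - 1) - (q : ℤ) ^ (2 * r - 3) + (q : ℤ) ^ (2 * (r - 2))
              - (q : ℤ) ^ (r - 2) }) ∧
      (MinimalCodes.nonzeroWeights C).ncard = 5 ∧
      (∃ wmin wmax : ℕ, IsLeast (MinimalCodes.nonzeroWeights C) wmin ∧
        IsGreatest (MinimalCodes.nonzeroWeights C) wmax ∧
        (wmin : ℚ) / (wmax : ℚ) > ((q : ℚ) ^ 2 - 1) / (q : ℚ) ^ 2) := by
  have : Finite K := Nat.finite_of_card_ne_zero (by rw [hK]; exact pow_ne_zero 2 hq.ne_zero)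
  refine ⟨MinimalCodes.exists_isProjectiveCodeOf _, fun n C hC => ?_⟩
  have := Fintype.ofFinite K
  have hq1 : 1 < q := hq.one_lt
  have hq3 : 3 ≤ q := by
    obtain ⟨k, rfl⟩ := hqodd
    omega
  have h2 := MinimalCodes.two_ne_zero_of_odd_card hK hqodd
  obtain ⟨i, hi⟩ := MinimalCodes.exists_sq_eq_neg_one hK hqodd
  obtain ⟨σ, hσ, hσq⟩ := MinimalCodes.exists_isConj hK hF
  have hcond : 4 * α ^ (q + 1) + (β ^ q - β) ^ 2 = 4 * (α * σ α) + (σ β - β) ^ 2 := by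
    rw [hσq, hσq, pow_succ']
  rw [hcond] at hαβ
  have hQ : (q : ℚ) ^ 2 - 1 ≠ 0 := by
    have : (1 : ℚ) < q := by exact_mod_cast hq1
    nlinarith
  have hKz : (Nat.card K : ℤ) = (q : ℤ) ^ 2 := by rw [hK]; push_cast; rfl
  -- Substituting q = p + 3, and u + 1 for a power of q, with p and u natural, turns the differences
  -- of weights into polynomials with nonnegative coefficients, which `positivity` can handle.
  obtain ⟨p, hp⟩ := Nat.exists_eq_add_of_le' hq3
  have hpz : (q : ℤ) = p + 3 := by exact_mod_cast hp
  have hdvd : ∀ k, k ≠ 0 → (q : ℤ) ∣ (q : ℤ) ^ k := fun k hk => dvd_pow_self _ hk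
  have hpow : ∀ k, ∃ u : ℕ, (q : ℤ) ^ k = u + 1 := fun k =>
    ⟨q ^ k - 1, by exact_mod_cast (Nat.sub_add_cancel (Nat.one_le_pow k _ (by omega))).symm⟩
  rcases hαβ with ⟨⟨k, hk⟩, hne⟩ | ⟨⟨k, hk⟩, d, hd, hsq⟩
  · obtain ⟨j, rfl⟩ : ∃ j, k = j + 1 + 1 := ⟨k - 2, by omega⟩
    subst hk
    have hμ := MinimalCodes.four_mul_conj_ne_one hσ hβ hne
    have hw := MinimalCodes.image_weightOf_of_even hσ hσq hq1 hK hF h2 hi hα hβ hμ (j + 1)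
    have hn := hC.length_hypersurface hσ hσq hq1 hK hF hα
    rw [← hKz, MinimalCodes.numSol_sum_sq_even h2 hi, hKz] at hn
    obtain ⟨u, hu⟩ := hpow (2 * j + 1)
    obtain ⟨h1, h3, h4, h5, h6, h7⟩ := MinimalCodes.five_weight_code hK hC hw
      (lt_of_lt_of_eq (b := ((q : ℤ) ^ (2 * j + 1)) ^ 2 * q ^ 4 * (q ^ 3 - q + 1))
        (by rw [hu, hpz]; ring_nf; positivity) (by ring))
      (sub_pos.1 (lt_of_lt_of_eq (b := (q : ℤ) ^ (2 * j + 1) * q * (q - 1))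
        (by rw [hu, hpz]; ring_nf; positivity) (by ring)))
      (sub_pos.1 (lt_of_lt_of_eq (b := (q : ℤ) ^ (2 * j + 1) * q * (q ^ 2 - q + 1))
        (by rw [hu, hpz]; ring_nf; positivity) (by ring)))
      (sub_pos.1 (lt_of_lt_of_eq (b := (q : ℤ) ^ (2 * j + 1) * q * (q - 1))
        (by rw [hu, hpz]; ring_nf; positivity) (by ring)))
      (sub_pos.1 (lt_of_lt_of_eq (b := (q : ℤ) ^ (2 * j + 1) * q *
          ((q : ℤ) ^ (2 * j + 1) * q ^ 3 * (q - 1) - q ^ 2 - q + 1))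
        (by rw [hu, hpz]; ring_nf; positivity) (by ring)))
      (hdvd _ (by omega))
      (dvd_sub (dvd_add (dvd_add (dvd_add (dvd_sub (hdvd _ (by omega)) (hdvd _ (by omega)))
        (hdvd _ (by omega))) (hdvd _ (by omega))) (hdvd _ (by omega))) (hdvd _ (by omega)))
      (dvd_add (dvd_add (dvd_sub (hdvd _ (by omega)) (hdvd _ (by omega))) (hdvd _ (by omega)))
        (hdvd _ (by omega)))
      (dvd_sub (dvd_add (dvd_add (dvd_sub (hdvd _ (by omega)) (hdvd _ (by omega)))
        (hdvd _ (by omega))) (hdvd _ (by omega))) (hdvd _ (by omega)))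
      (dvd_add (dvd_sub (hdvd _ (by omega)) (hdvd _ (by omega))) (hdvd _ (by omega)))
      -- The Ashikhmin–Barg gap q² w₅ - (q² - 1) w₁ is q^{2r-2} for r odd.
      (sub_pos.1 (lt_of_lt_of_eq (b := ((q : ℤ) ^ (2 * j + 1)) ^ 2 * q ^ 6)
        (by rw [hu, hpz]; positivity) (by ring)))
    refine ⟨h1, h3, h4, fun _ => ⟨?_, ?_⟩,
      fun h => absurd h (Nat.not_even_iff_odd.2 ⟨_, rfl⟩), h6, h7⟩
    · rw [show 2 * (2 * (j + 1 + 1) + 1) - 1 = 4 * j + 9 by omega,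
        show 2 * (j + 1 + 1) + 1 - 1 = 2 * j + 4 by omega]
      have hnq : ((q : ℚ) ^ 2 - 1) * n = ((q : ℚ) ^ 2 - 1) * (q : ℚ) ^ (2 * (2 * (j + 1 + 1)) + 1)
          + (((q : ℚ) ^ 2) ^ (2 * (j + 1 + 1)) - ((q : ℚ) ^ 2) ^ (j + 1 + 1)
            + ((q : ℚ) ^ 2) ^ (j + 1 + 1 + 1) - 1) := by exact_mod_cast hn
      apply mul_left_cancel₀ hQ
      rw [hnq]
      field_simp
      ring
    · rw [h5, show 2 * (2 * (j + 1 + 1) + 1) - 1 = 4 * (j + 1) + 5 by omega,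
        show 2 * (2 * (j + 1 + 1) + 1) - 3 = 4 * (j + 1) + 3 by omega,
        show 2 * (2 * (j + 1 + 1) + 1 - 2) = 4 * (j + 1) + 2 by omega,
        show 2 * (j + 1 + 1) + 1 - 1 = 2 * (j + 1) + 2 by omega,
        show 2 * (j + 1 + 1) + 1 - 2 = 2 * (j + 1) + 1 by omega,
        show 2 * (j + 1 + 1) + 1 - 3 = 2 * (j + 1) by omega]
  · obtain ⟨j, rfl⟩ : ∃ j, k = j + 1 + 1 := ⟨k - 2, by omega⟩
    obtain rfl : r = 2 * (j + 1) + 1 + 1 := by omega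
    have hne : 4 * (α * σ α) + (σ β - β) ^ 2 ≠ 0 := fun h => hsq (by
      rw [show d = 0 from Subtype.ext (hd.trans h)]
      exact IsSquare.zero)
    have hμ := MinimalCodes.four_mul_conj_ne_one hσ hβ hne
    have hw := MinimalCodes.image_weightOf_of_odd hσ hσq hq1 hK hF h2 hi hα hβ hμ
      (MinimalCodes.exists_sq_eq_of_not_isSquare hσ h2 hβ hd hsq) j
    have hn := hC.length_hypersurface hσ hσq hq1 hK hF hα
    rw [MinimalCodes.numSol_sum_sq_odd h2 hi, hKz] at hn
    obtain ⟨u, hu⟩ := hpow (2 * j)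
    obtain ⟨h1, h3, h4, h5, h6, h7⟩ := MinimalCodes.five_weight_code hK hC hw
      (lt_of_lt_of_eq (b := (q : ℤ) ^ (2 * j) * q ^ 2 *
          ((q : ℤ) ^ (2 * j) * q ^ 2 * (q ^ 3 - q + 1) - 1))
        (by rw [hu, hpz]; ring_nf; positivity) (by ring))
      (sub_pos.1 (lt_of_lt_of_eq (b := (q : ℤ) ^ (2 * j) * q ^ 2)
        (by rw [hu, hpz]; positivity) (by ring)))
      (sub_pos.1 (lt_of_lt_of_eq (b := (q : ℤ) ^ (2 * j) * q ^ 2)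
        (by rw [hu, hpz]; positivity) (by ring)))
      (sub_pos.1 (lt_of_lt_of_eq (b := (q : ℤ) ^ (2 * j) * q ^ 2 * (q - 2))
        (by rw [hu, hpz]; ring_nf; positivity) (by ring)))
      (sub_pos.1 (lt_of_lt_of_eq (b := (q : ℤ) ^ (2 * j) * q ^ 2 *
          ((q - 1) * ((q : ℤ) ^ (2 * j) * q ^ 2 - 1)))
        (by rw [hu, hpz]; ring_nf; positivity) (by ring)))
      (hdvd _ (by omega))
      (dvd_sub (dvd_add (dvd_add (dvd_sub (hdvd _ (by omega)) (hdvd _ (by omega)))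
        (hdvd _ (by omega))) (hdvd _ (by omega))) (hdvd _ (by omega)))
      (dvd_add (dvd_add (dvd_sub (hdvd _ (by omega)) (hdvd _ (by omega))) (hdvd _ (by omega)))
        (hdvd _ (by omega)))
      (dvd_add (dvd_sub (hdvd _ (by omega)) (hdvd _ (by omega))) (hdvd _ (by omega)))
      (dvd_sub (dvd_add (dvd_sub (hdvd _ (by omega)) (hdvd _ (by omega))) (hdvd _ (by omega)))
        (hdvd _ (by omega)))
      -- For r even the same gap is q^{2r-2} - q^r.
      (sub_pos.1 (lt_of_lt_of_eq (b := (q : ℤ) ^ (2 * j) * q ^ 4 * ((q : ℤ) ^ (2 * j) * q ^ 2 - 1))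
        (by rw [hu, hpz]; ring_nf; positivity) (by ring)))
    refine ⟨h1, h3, h4, fun h => absurd h (Nat.not_odd_iff_even.2 ⟨j + 1 + 1, hk⟩),
      fun _ => ⟨?_, ?_⟩, h6, h7⟩
    · rw [show 2 * (2 * (j + 1) + 1 + 1) - 1 = 4 * j + 7 by omega,
        show 2 * (j + 1) + 1 + 1 - 1 = 2 * j + 3 by omega]
      have hnq : ((q : ℚ) ^ 2 - 1) * n = ((q : ℚ) ^ 2 - 1) * (q : ℚ) ^ (2 * (2 * (j + 1) + 1) + 1)
          + ((q : ℚ) ^ 2 * ((q : ℚ) ^ 2) ^ (2 * (j + 1)) - 1) := by exact_mod_cast hn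
      apply mul_left_cancel₀ hQ
      rw [hnq]
      field_simp
      ring
    · rw [h5, show 2 * (2 * (j + 1) + 1 + 1) - 1 = 4 * j + 7 by omega,
        show 2 * (2 * (j + 1) + 1 + 1) - 3 = 4 * j + 5 by omega,
        show 2 * (2 * (j + 1) + 1 + 1 - 2) = 4 * j + 4 by omega,
        show 2 * (j + 1) + 1 + 1 - 1 = 2 * j + 3 by omega,
        show 2 * (j + 1) + 1 + 1 - 2 = 2 * j + 2 by omega]
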